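/- **Setting (Problem B).** Let $r\ge 1$, let $f,g:\mathbb R^r\to\mathbb R$, $F:\mathbb R^r\times\mathbb R\to\mathbb R$, $E:\mathbb R^r\times\mathbb R^r\to\mathbb R$ be Lipschitz continuous, $g(x)\neq 0$ for all $x$, and $x_0\in\mathbb R^r$. Problem B is to minimize $$J(x(\cdot),u(\cdot))=\int_{-1}^1F(x(t),u(t))\,dt+E(x(-1),x(1))$$ over all pairs with $u\in L^\infty(-1,1)$ and $x:[-1,1]\to\mathbb R^r$ absolutely continuous such that almost everywhere $\dot x_i=x_{i+1}$ $(1\le i<r)$, $\dot x_r=f(x)+g(x)u$, and $x(-1)=x_0$. **Discretization (Problem $B^N(J)$).** Let $L_n$ be the Legendre polynomial of degree $n$, and let $-1=t_0<\dots<t_N=1$ be the LGL nodes, i.e. $\pm1$ and the roots of $\dot L_N$. Let $D$ be the $(N+1)\times(N+1)$ differentiation matrix $D_{ik}=\frac{L_N(t_i)}{L_N(t_k)}\frac1{t_i-t_k}$ for $i\ne k$, $D_{00}=-\frac{N(N+1)}4$, $D_{NN}=\frac{N(N+1)}4$, and $D_{ii}=0$ otherwise. For discrete states $\bar x^{Nk}\in\mathbb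 R^r$ and controls $\bar u^{Nk}\in\mathbb R$, $0\le k\le N$, let $\bar x_i^N=(\bar x_i^{N0},\dots,\bar x_i^{NN})^T$, let $x_i^N(t)$ be the polynomial of degree at most $N$ with $x_i^N(t_k)=\bar x_i^{Nk}$, and let $u^N(t)=\bigl(\dot x_r^N(t)-f(x^N(t))\bigr)/g(x^N(t))$. Fix $m_1\ge1$ and bounds $\underline b,\bar b\in\mathbb R^{r+1}$, $\underline b_j,\bar b_j\in\mathbb R$ $(1\le j\le m_1-1)$, $d\in\mathbb R$. Let $a_n^N(m_1)$ be the $n$-th coefficient in the Legendre expansion of the interpolation polynomial of $D^{m_1}\bar x_r^N$. Problem $B^N(J)$ is to minimize $J(x^N(\cdot),u^N(\cdot))$ (with the integral evaluated exactly) over all $(\bar x^N,\bar u^N)$ with $$D\bar x_i^N=\bar x_{i+1}^N\ (1\le i<r),\qquad D\bar x_r^N=\bigl(f(\bar x^{Nk})+g(\bar x^{Nk})\bar u^{Nk}\bigr)_{k=0}^N,\qquad \bar x^{N0}=x_0,$$ $$\underline b\le(\bar x^{Nk},\bar u^{Nk})\le\bar b\ (0\le k\le N),\qquad \underline b_j\le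 (D^j\bar x_r^N)_0\le\bar b_j\ (1\le j\le m_1-1),\qquad \sum_{n=0}^{N-r-m_1+1}|a_n^N(m_1)|\le d .$$ **Theorem.** Suppose that Problem B has an optimal solution $(x^*,u^*)$ such that, for some $m\ge2$, $x_r^*$ has a strong (classical) $m$-th derivative on $[-1,1]$ that has bounded variation. Let $1\le m_1\le m-1$ and let $f,g,F$ be $C^m$. Suppose that the bounds in Problem $B^N(J)$ are large enough in the following sense: * $x^*(t)$, for every $t\in[-1,1]$, lies in the interior of the state part of the box $[\underline b,\bar b]$, and for some $\varepsilon>0$ one has $\underline b_{r+1}+\varepsilon\le u^*(t)\le\bar b_{r+1}-\varepsilon$ for almost every $t$; * $\underline b_j<(x_r^*)^{(j)}(-1)<\bar b_j$ for $1\le j\le m_1-1$; * $d>\frac12\left|\int_{-1}^1(x_r^*)^{(m_1)}(t)\,dt\right|+\frac6{\sqrt\pi}\,(U+V)\,\zeta(3/2)$, where $U$ is an upper bound of $|(x_r^*)^{(m_1+1)}|$ on $[-1,1]$, $V$ is the total variation of $(x_r^*)^{(m_1+1)}$ on $[-1,1]$ and $\zeta(3/2)=\sum_{k\ge1}k^{-3/2}$.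 Let $\{(\bar x^{*N},\bar u^{*N})\}_{N\ge N_1}$ be any sequence of optimal solutions of Problem $B^N(J)$, with interpolations $(x^{*N}(t),u^{*N}(t))$. Then there is a constant $M_1$ independent of $N$ such that, for all $N\ge N_1$ with $N>r+m_1+1$, $$\left|J(x^*(\cdot),u^*(\cdot))-J(x^{*N}(\cdot),u^{*N}(\cdot))\right|\le\frac{M_1}{(N-r-m_1-1)^{2m-2m_1-1}} .$$ -/

import Mathlib

open Set MeasureTheory Polynomial
open scoped Matrix

noncomputable section

namespace PSControl

/-! The continuous-time optimal control problem on the interval [-1, 1]. -/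

/-- The index of the last state coordinate `x_r`. -/
def lastIdx (r : ℕ) [NeZero r] : Fin r := ⟨r - 1, Nat.sub_one_lt (NeZero.ne r)⟩

/-- Data of the Bolza problem in feedback linearizable normal form with state in `ℝ^r`:
running cost `F`, endpoint cost `E`, dynamics `f`, `g` with `g` nowhere zero, initial state `x₀`. -/
structure ControlProblem (r : ℕ) where
  f : (Fin r → ℝ) → ℝ
  g : (Fin r → ℝ) → ℝ
  F : (Fin r → ℝ) × ℝ → ℝ
  E : (Fin r → ℝ) × (Fin r → ℝ) → ℝ
  x₀ : Fin r → ℝ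
  f_lipschitz : ∃ K, LipschitzWith K f
  g_lipschitz : ∃ K, LipschitzWith K g
  F_lipschitz : ∃ K, LipschitzWith K F
  E_lipschitz : ∃ K, LipschitzWith K E
  g_ne_zero : ∀ x, g x ≠ 0

variable {r : ℕ}

/-- The cost `J(x, u) = ∫_{-1}^{1} F(x(t), u(t)) dt + E(x(-1), x(1))`. -/
def ControlProblem.cost (P : ControlProblem r) (x : ℝ → Fin r → ℝ) (u : ℝ → ℝ) : ℝ :=
  (∫ t in (-1 : ℝ)..1, P.F (x t, u t)) + P.E (x (-1), x 1)

/-- Feasible state-control pairs: `u` is an essentially bounded control on `[-1, 1]`, `x` is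
absolutely continuous, the chain `ẋ_i = x_{i+1}` (`i < r`), `ẋ_r = f(x) + g(x) u` holds almost
everywhere, and `x(-1) = x₀`. -/
structure ControlProblem.IsFeasible [NeZero r] (P : ControlProblem r)
    (x : ℝ → Fin r → ℝ) (u : ℝ → ℝ) : Prop where
  control : MemLp u ⊤ (volume.restrict (Icc (-1 : ℝ) 1))
  state : ∀ i, AbsolutelyContinuousOnInterval (fun t => x t i) (-1) 1
  chain : ∀ i j : Fin r, (j : ℕ) = i + 1 →
    ∀ᵐ t ∂(volume.restrict (Icc (-1 : ℝ) 1)), HasDerivAt (fun s => x s i) (x t j) t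
  last : ∀ᵐ t ∂(volume.restrict (Icc (-1 : ℝ) 1)),
    HasDerivAt (fun s => x s (lastIdx r)) (P.f (x t) + P.g (x t) * u t) t
  init : x (-1) = P.x₀

/-- Optimal solutions: feasible pairs of least cost. -/
def ControlProblem.IsOptimal [NeZero r] (P : ControlProblem r)
    (x : ℝ → Fin r → ℝ) (u : ℝ → ℝ) : Prop :=
  P.IsFeasible x u ∧ ∀ y v, P.IsFeasible y v → P.cost x u ≤ P.cost y v

/-- The classical (strong) `k`-th derivative on `[-1, 1]`, one-sided at the endpoints. -/
def strongDeriv (k : ℕ) (ξ : ℝ → ℝ) : ℝ → ℝ := iteratedDerivWithin k ξ (Icc (-1) 1)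

/-- `ξ` has a strong `m`-th derivative on `[-1, 1]`, and this derivative has bounded variation. -/
def HasStrongDerivBV (m : ℕ) (ξ : ℝ → ℝ) : Prop :=
  (∀ k < m, DifferentiableOn ℝ (strongDeriv k ξ) (Icc (-1) 1)) ∧
    BoundedVariationOn (strongDeriv m ξ) (Icc (-1) 1)

/-! Legendre polynomials, Legendre-Gauss-Lobatto nodes, differentiation matrix. -/

/-- The Legendre polynomial `L_n` (Rodrigues formula). -/
def legendrePoly (n : ℕ) : ℝ[X] :=
  C (1 / (2 ^ n * (n.factorial : ℝ))) * derivative^[n] ((X ^ 2 - 1) ^ n)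

/-- The set of LGL nodes: `-1`, `1` and the roots of the derivative of `L_N`. -/
def lglSet (N : ℕ) : Finset ℝ :=
  insert (-1) (insert 1 (derivative (legendrePoly N)).roots.toFinset)

/-- The `k`-th LGL node `t_k`, in increasing order. For `N ≥ 1` the set above has `N + 1` elements,
so that the default value `0` is never used. -/
def lglNode (N : ℕ) (k : Fin (N + 1)) : ℝ := ((lglSet N).sort (· ≤ ·)).getD k 0

/-- The differentiation matrix `D` at the LGL nodes. -/
def diffMatrix (N : ℕ) : Matrix (Fin (N + 1)) (Fin (N + 1)) ℝ :=
  Matrix.of fun i k =>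
    if i ≠ k then
      (legendrePoly N).eval (lglNode N i) / (legendrePoly N).eval (lglNode N k) *
        (1 / (lglNode N i - lglNode N k))
    else if i = 0 then -((N : ℝ) * (N + 1) / 4)
    else if i = Fin.last N then (N : ℝ) * (N + 1) / 4
    else 0

/-- The polynomial of degree at most `N` with the values `v k` at the LGL nodes `t_k`. -/
def interp (N : ℕ) (v : Fin (N + 1) → ℝ) : ℝ[X] :=
  Lagrange.interpolate Finset.univ (lglNode N) v

/-- The `n`-th coefficient in the Legendre expansion of `h` on `[-1, 1]`. -/
def legendreCoeff (h : ℝ → ℝ) (n : ℕ) : ℝ :=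
  ((n : ℝ) + 1 / 2) * ∫ t in (-1 : ℝ)..1, h t * (legendrePoly n).eval t

/-! The discretized problem with exact integration of the cost. -/

/-- The bounds of the search region of the discretized problem. -/
structure SearchBounds (r : ℕ) where
  xlo : Fin r → ℝ
  xhi : Fin r → ℝ
  ulo : ℝ
  uhi : ℝ
  dlo : ℕ → ℝ
  dhi : ℕ → ℝ
  d : ℝ

/-- The interpolated state `x^N(t)` of discrete states `xb k`, `0 ≤ k ≤ N`. -/
def stateInterp {N : ℕ} (xb : Fin (N + 1) → Fin r → ℝ) (t : ℝ) : Fin r → ℝ :=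
  fun i => (interp N fun k => xb k i).eval t

/-- The interpolated control `u^N = (ẋ_r^N - f(x^N)) / g(x^N)`. -/
def ControlProblem.controlInterp [NeZero r] (P : ControlProblem r) {N : ℕ}
    (xb : Fin (N + 1) → Fin r → ℝ) (t : ℝ) : ℝ :=
  ((derivative (interp N fun k => xb k (lastIdx r))).eval t - P.f (stateInterp xb t)) /
    P.g (stateInterp xb t)

/-- The cost of the interpolation of a discrete pair, with the integral evaluated exactly. -/
def ControlProblem.discreteCost [NeZero r] (P : ControlProblem r) {N : ℕ}
    (xb : Fin (N + 1) → Fin r → ℝ) : ℝ :=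
  P.cost (stateInterp xb) (P.controlInterp xb)

/-- The constraints of the discretized problem with `N + 1` nodes and regulation order `m₁`. -/
structure ControlProblem.IsDiscreteFeasible [NeZero r] (P : ControlProblem r)
    (b : SearchBounds r) (m₁ N : ℕ)
    (xb : Fin (N + 1) → Fin r → ℝ) (ub : Fin (N + 1) → ℝ) : Prop where
  chain : ∀ i j : Fin r, (j : ℕ) = i + 1 →
    (diffMatrix N *ᵥ fun k => xb k i) = fun k => xb k j
  last : (diffMatrix N *ᵥ fun k => xb k (lastIdx r)) =
    fun k => P.f (xb k) + P.g (xb k) * ub k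
  init : xb 0 = P.x₀
  state_mem : ∀ k i, b.xlo i ≤ xb k i ∧ xb k i ≤ b.xhi i
  control_mem : ∀ k, b.ulo ≤ ub k ∧ ub k ≤ b.uhi
  initial_deriv : ∀ j, 1 ≤ j → j ≤ m₁ - 1 →
    b.dlo j ≤ ((diffMatrix N ^ j) *ᵥ fun k => xb k (lastIdx r)) 0 ∧
      ((diffMatrix N ^ j) *ᵥ fun k => xb k (lastIdx r)) 0 ≤ b.dhi j
  /-- The sum runs over `0 ≤ n ≤ N - r - m₁ + 1`. -/
  spectral : ∑ n ∈ Finset.range (N + 2 - (r + m₁)),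
    |legendreCoeff
      (fun t => (interp N ((diffMatrix N ^ m₁) *ᵥ fun k => xb k (lastIdx r))).eval t) n| ≤ b.d

/-- Optimal solutions of the discretized problem with exact integration. -/
def ControlProblem.IsDiscreteOptimal [NeZero r] (P : ControlProblem r)
    (b : SearchBounds r) (m₁ N : ℕ)
    (xb : Fin (N + 1) → Fin r → ℝ) (ub : Fin (N + 1) → ℝ) : Prop :=
  P.IsDiscreteFeasible b m₁ N xb ub ∧
    ∀ yb vb, P.IsDiscreteFeasible b m₁ N yb vb → P.discreteCost xb ≤ P.discreteCost yb

/-- The bounds are large enough for the optimal pair `(x, u)`: the trajectory lies in the interior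
of the box (for the control, up to null sets, with a positive margin), the initial derivatives of
`x_r` lie in the interior of their intervals, and `d` exceeds the modulus of the zeroth Legendre
coefficient of `x_r^{(m₁)}` plus `6 / √π * (U + V) * ζ(3/2)`, where `U` is a bound and `V` is the
total variation of `x_r^{(m₁+1)}`. -/
structure SearchBounds.LargeEnough [NeZero r] (b : SearchBounds r) (m₁ : ℕ)
    (x : ℝ → Fin r → ℝ) (u : ℝ → ℝ) : Prop where
  state : ∀ t ∈ Icc (-1 : ℝ) 1, ∀ i, b.xlo i < x t i ∧ x t i < b.xhi i
  control : ∃ ε > 0, ∀ᵐ t ∂(volume.restrict (Icc (-1 : ℝ) 1)),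
    b.ulo + ε ≤ u t ∧ u t ≤ b.uhi - ε
  initial_deriv : ∀ j, 1 ≤ j → j ≤ m₁ - 1 →
    b.dlo j < strongDeriv j (fun t => x t (lastIdx r)) (-1) ∧
      strongDeriv j (fun t => x t (lastIdx r)) (-1) < b.dhi j
  spectral : ∃ U : ℝ,
    (∀ t ∈ Icc (-1 : ℝ) 1, |strongDeriv (m₁ + 1) (fun t => x t (lastIdx r)) t| ≤ U) ∧
    |legendreCoeff (strongDeriv m₁ fun t => x t (lastIdx r)) 0| +
      6 / √Real.pi *
        (U + (eVariationOn (strongDeriv (m₁ + 1) fun t => x t (lastIdx r))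
          (Icc (-1) 1)).toReal) *
        (∑' k : ℕ, 1 / ((k : ℝ) + 1) ^ (3 / 2 : ℝ)) < b.d

end PSControl

end

/-!
The interpolated states of the discretized problem are polynomials that satisfy the chain of
differential equations exactly, because the differentiation matrix at the LGL nodes differentiates
polynomials of degree at most `N` (`derivative_interp_eq`). Hence every discretely feasible point
is feasible for the continuous problem (`isFeasible_of_isDiscreteFeasible`), and the discrete
optimal cost is at least the continuous one. It remains to exhibit, for large `N`, a discretely
feasible point whose cost is at most `J(x*, u*) + O(N^{-(2m - 2m₁ - 1)})`.

Let `h = (x_r*)^{(m₁)}` and let `p` be its Legendre expansion truncated after degree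
`n = N - r - m₁ + 1`. Integrating `p` repeatedly, with the initial values of `x*` and its
derivatives, gives a polynomial state `y`. Since `h - p` is orthogonal to all polynomials of degree
at most `n`, every error `y_i - x_i*` vanishes not only at `-1` but also at `1`
(`exists_chain_approx`). The spectral constraint involves exactly the Legendre coefficients of `h`,
which are bounded through the total variation of `h'` (`abs_legendreCoeff_succ_le`); the other
constraints are strict inequalities along `x*` and persist under uniform approximation.

The uniform error `ε` of `p` is `O(n^{-(m - m₁ - 1/2)})` (`exists_sub_legendreTrunc_le`): the
coefficients are integrated by parts until the derivative of bounded variation is reached, and the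
primitive of `P_k` vanishing at `±1` is at most `k^{-3/2}` on `[-1, 1]` by Sonine's argument
(`abs_legendrePrim_le`).

The cost exceeds the optimum only by `O(ε²)`, although the endpoint cost is merely Lipschitz
(`IsOptimal.exists_cost_le`): the reflected state `2 x* - y` is feasible as well and so costs at
least `J(x*, u*)`, both states have the endpoints of `x*`, and therefore
`J(y) - J(x*) ≤ J(y) + J(2 x* - y) - 2 J(x*)` is the integral of a second difference of a `C²`
function.
-/

namespace PSControl

/-! ### Legendre polynomials: algebraic identities -/

/-- `P'_{n+1} = X P'_n + (n + 1) P_n`. -/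
lemma derivative_legendrePoly_succ (n : ℕ) :
    derivative (legendrePoly (n + 1)) =
      X * derivative (legendrePoly n) + ((n : ℝ[X]) + 1) * legendrePoly n := by
  have h1 : derivative^[n + 2] ((X ^ 2 - 1 : ℝ[X]) ^ (n + 1)) =
      C (2 * ((n : ℝ) + 1)) * (X * derivative^[n + 1] ((X ^ 2 - 1) ^ n) +
        ((n : ℝ[X]) + 1) * derivative^[n] ((X ^ 2 - 1) ^ n)) := by
    have h0 : derivative ((X ^ 2 - 1 : ℝ[X]) ^ (n + 1)) =
        C (2 * ((n : ℝ) + 1)) * (X * (X ^ 2 - 1) ^ n) := by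
      rw [derivative_pow_succ]
      simp [C_ofNat]
      ring
    rw [Function.iterate_succ_apply, h0, iterate_derivative_C_mul, mul_comm X,
      iterate_derivative_mul_X, nsmul_eq_mul]
    push_cast
    ring
  simp only [legendrePoly, derivative_C_mul, ← Function.iterate_succ_apply' (f := derivative)]
  have hfac : ((n.factorial : ℕ) : ℝ) ≠ 0 := by positivity
  have hc : (1 : ℝ) / (2 ^ (n + 1) * ((n + 1).factorial : ℝ)) * (2 * ((n : ℝ) + 1)) =
      1 / (2 ^ n * (n.factorial : ℝ)) := by
    rw [Nat.factorial_succ]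
    push_cast
    field_simp
    ring
  rw [h1, ← mul_assoc, ← C_mul, hc]
  ring

/-- `P'_{n+2} - P'_n = (2n + 3) P_{n+1}`. -/
lemma derivative_legendrePoly_sub (n : ℕ) :
    derivative (legendrePoly (n + 2)) =
      derivative (legendrePoly n) + (2 * (n : ℝ[X]) + 3) * legendrePoly (n + 1) := by
  have h0 : derivative^[2] ((X ^ 2 - 1 : ℝ[X]) ^ (n + 2)) =
      C (2 * ((n : ℝ) + 2) * (2 * n + 3)) * (X ^ 2 - 1) ^ (n + 1) +
        C (4 * ((n : ℝ) + 2) * (n + 1)) * (X ^ 2 - 1) ^ n := by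
    rw [Function.iterate_succ_apply, Function.iterate_one, derivative_pow_succ]
    simp only [derivative_sub, derivative_one, derivative_mul, derivative_C,
      derivative_pow_succ, derivative_X]
    simp [C_ofNat]
    ring
  have h1 : derivative^[n + 3] ((X ^ 2 - 1 : ℝ[X]) ^ (n + 2)) =
      C (2 * ((n : ℝ) + 2) * (2 * n + 3)) * derivative^[n + 1] ((X ^ 2 - 1) ^ (n + 1)) +
        C (4 * ((n : ℝ) + 2) * (n + 1)) * derivative^[n + 1] ((X ^ 2 - 1) ^ n) := by
    rw [show n + 3 = (n + 1) + 2 from rfl, Function.iterate_add_apply, h0,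
      iterate_map_add, iterate_derivative_C_mul, iterate_derivative_C_mul]
  simp only [legendrePoly, derivative_C_mul, ← Function.iterate_succ_apply' (f := derivative)]
  have hfac : ((n.factorial : ℕ) : ℝ) ≠ 0 := by positivity
  have hc : (1 : ℝ) / (2 ^ (n + 2) * ((n + 2).factorial : ℝ)) * (2 * ((n : ℝ) + 2) * (2 * n + 3)) =
      (2 * n + 3) * (1 / (2 ^ (n + 1) * ((n + 1).factorial : ℝ))) := by
    rw [Nat.factorial_succ (n + 1)]
    push_cast
    field_simp
    ring
  have hc' : (1 : ℝ) / (2 ^ (n + 2) * ((n + 2).factorial : ℝ)) * (4 * ((n : ℝ) + 2) * (n + 1)) =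
      1 / (2 ^ n * (n.factorial : ℝ)) := by
    rw [Nat.factorial_succ (n + 1), Nat.factorial_succ n]
    push_cast
    field_simp
    ring
  rw [h1, mul_add, ← mul_assoc, ← mul_assoc, ← C_mul, ← C_mul, hc, hc']
  simp [C_ofNat]
  ring

lemma legendrePoly_zero : legendrePoly 0 = 1 := by simp [legendrePoly]

lemma legendrePoly_one : legendrePoly 1 = X := by
  apply Polynomial.funext
  intro x
  simp [legendrePoly, one_add_one_eq_two]

/-- `P'_n = X P'_{n+1} - (n + 1) P_{n+1}`. -/
lemma derivative_legendrePoly_pred (n : ℕ) :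
    derivative (legendrePoly n) = X * derivative (legendrePoly (n + 1)) -
      ((n : ℝ[X]) + 1) * legendrePoly (n + 1) := by
  have h1 := derivative_legendrePoly_succ (n + 1)
  have h2 := derivative_legendrePoly_sub n
  push_cast at h1
  linear_combination h1 - h2

/-- `(1 - X²) P'_{n+1} = (n + 1) (P_n - X P_{n+1})`. -/
lemma one_sub_sq_mul_derivative_legendrePoly (n : ℕ) :
    (1 - X ^ 2) * derivative (legendrePoly (n + 1)) =
      ((n : ℝ[X]) + 1) * (legendrePoly n - X * legendrePoly (n + 1)) := by
  have h1 := derivative_legendrePoly_succ n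
  have h2 := derivative_legendrePoly_pred n
  linear_combination h1 + X * h2

/-- `(1 - X²) P'_n = (n + 1) (X P_n - P_{n+1})`. -/
lemma one_sub_sq_mul_derivative_legendrePoly' (n : ℕ) :
    (1 - X ^ 2) * derivative (legendrePoly n) =
      ((n : ℝ[X]) + 1) * (X * legendrePoly n - legendrePoly (n + 1)) := by
  have h1 := derivative_legendrePoly_succ n
  have h2 := derivative_legendrePoly_pred n
  linear_combination X * h1 + h2

lemma legendrePoly_three_term (n : ℕ) :
    ((n : ℝ[X]) + 2) * legendrePoly (n + 2) =
      (2 * (n : ℝ[X]) + 3) * X * legendrePoly (n + 1) - ((n : ℝ[X]) + 1) * legendrePoly n := by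
  have h1 := one_sub_sq_mul_derivative_legendrePoly n
  have h2 := one_sub_sq_mul_derivative_legendrePoly' (n + 1)
  push_cast at h2
  rw [show n + 2 = n + 1 + 1 from rfl]
  linear_combination h2 - h1

/-- Legendre's differential equation in divergence form. -/
lemma legendrePoly_ode (n : ℕ) :
    derivative ((1 - X ^ 2) * derivative (legendrePoly n)) =
      -((n : ℝ[X]) * ((n : ℝ[X]) + 1)) * legendrePoly n := by
  rw [one_sub_sq_mul_derivative_legendrePoly']
  have h1 := derivative_legendrePoly_succ n
  simp
  linear_combination (-(n : ℝ[X]) - 1) * h1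

lemma legendrePoly_eval_one (n : ℕ) : (legendrePoly n).eval 1 = 1 := by
  induction n with
  | zero => simp [legendrePoly_zero]
  | succ n ih =>
    have h := congrArg (eval 1) (one_sub_sq_mul_derivative_legendrePoly' n)
    simp at h
    have : (n : ℝ) + 1 ≠ 0 := by positivity
    rcases h with h | h
    · exact absurd h this
    · linarith

lemma legendrePoly_eval_neg (n : ℕ) (x : ℝ) :
    (legendrePoly n).eval (-x) = (-1) ^ n * (legendrePoly n).eval x := by
  induction n using Nat.twoStepInduction with
  | zero => simp [legendrePoly_zero]
  | one => simp [legendrePoly_one]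
  | more n h1 h2 =>
    have e1 := congrArg (eval (-x)) (legendrePoly_three_term n)
    have e2 := congrArg (eval x) (legendrePoly_three_term n)
    simp only [eval_mul, eval_sub, eval_add, eval_X, eval_natCast, eval_ofNat, eval_one,
      h1, h2] at e1 e2
    have : (n : ℝ) + 2 ≠ 0 := by positivity
    apply mul_left_cancel₀ this
    rw [e1, pow_add]
    linear_combination -(-1) ^ n * e2

lemma derivative_legendrePoly_eval_neg (n : ℕ) (x : ℝ) :
    (derivative (legendrePoly n)).eval (-x) =
      (-1) ^ (n + 1) * (derivative (legendrePoly n)).eval x := by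
  have h : (legendrePoly n).comp (-X) = C ((-1) ^ n) * legendrePoly n :=
    Polynomial.funext fun y => by simp [legendrePoly_eval_neg]
  have h' := congrArg (eval x) (congrArg derivative h)
  simp only [derivative_comp, derivative_neg, derivative_X, derivative_C_mul, eval_mul, eval_neg,
    eval_one, eval_C, eval_comp, eval_X] at h'
  rw [pow_succ]
  linear_combination -h'

lemma legendrePoly_coeff (n : ℕ) :
    (legendrePoly n).natDegree ≤ n ∧ 0 < (legendrePoly n).coeff n := by
  constructor
  · refine (natDegree_C_mul_le _ _).trans ((natDegree_iterate_derivative _ _).trans ?_)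
    have : ((X ^ 2 - 1 : ℝ[X]) ^ n).natDegree ≤ n * 2 :=
      natDegree_pow_le_of_le n (by compute_degree)
    omega
  · have h : ((X ^ 2 - 1 : ℝ[X]) ^ n).coeff (n + n) = 1 := by
      have hm : (X ^ 2 - 1 : ℝ[X]).Monic := by monicity!
      have hd : ((X ^ 2 - 1 : ℝ[X]) ^ n).natDegree = n + n := by
        rw [hm.natDegree_pow, show (X ^ 2 - 1 : ℝ[X]).natDegree = 2 by compute_degree!]
        ring
      rw [← hd]
      exact hm.pow n
    rw [legendrePoly, coeff_C_mul, coeff_iterate_derivative, h, nsmul_eq_mul, mul_one]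
    have : 0 < (n + n).descFactorial n := Nat.descFactorial_pos.2 (by omega)
    positivity

lemma natDegree_legendrePoly (n : ℕ) : (legendrePoly n).natDegree = n :=
  natDegree_eq_of_le_of_coeff_ne_zero (legendrePoly_coeff n).1 (legendrePoly_coeff n).2.ne'

lemma legendrePoly_ne_zero (n : ℕ) : legendrePoly n ≠ 0 := fun h => by
  simpa [h] using legendrePoly_eval_one n

/-! ### Legendre polynomials: orthogonality and uniform bounds -/

/-- The primitive of `P_n` that vanishes at `±1` (for `n ≥ 1`). -/
noncomputable def legendrePrim (n : ℕ) : ℝ[X] :=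
  C (-1 / ((n : ℝ) * (n + 1))) * ((1 - X ^ 2) * derivative (legendrePoly n))

lemma derivative_legendrePrim {n : ℕ} (hn : 1 ≤ n) :
    derivative (legendrePrim n) = legendrePoly n := by
  have : (n : ℝ) * (n + 1) ≠ 0 := by positivity
  rw [legendrePrim, derivative_C_mul, legendrePoly_ode]
  rw [show -((n : ℝ[X]) * ((n : ℝ[X]) + 1)) = C (-((n : ℝ) * (n + 1))) by simp,
    ← mul_assoc, ← C_mul]
  rw [show -1 / ((n : ℝ) * (n + 1)) * -((n : ℝ) * (n + 1)) = 1 by field_simp]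
  simp

lemma legendrePrim_eval_one (n : ℕ) : (legendrePrim n).eval 1 = 0 := by simp [legendrePrim]

lemma legendrePrim_eval_neg_one (n : ℕ) : (legendrePrim n).eval (-1) = 0 := by
  simp [legendrePrim]

lemma legendrePrim_succ_eq (n : ℕ) :
    legendrePrim (n + 1) = C (1 / (2 * (n : ℝ) + 3)) * (legendrePoly (n + 2) - legendrePoly n) := by
  have h1 := one_sub_sq_mul_derivative_legendrePoly n
  have h2 := one_sub_sq_mul_derivative_legendrePoly' (n + 1)
  have h3 : (((n : ℝ[X]) + 1) + ((n : ℝ[X]) + 2)) *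
      ((1 - X ^ 2) * derivative (legendrePoly (n + 1))) =
      ((n : ℝ[X]) + 1) * ((n : ℝ[X]) + 2) * (legendrePoly n - legendrePoly (n + 2)) := by
    push_cast at h2
    linear_combination ((n : ℝ[X]) + 2) * h1 + ((n : ℝ[X]) + 1) * h2
  apply Polynomial.funext
  intro x
  have h4 := congrArg (eval x) h3
  have : (n : ℝ) + 1 ≠ 0 := by positivity
  have : (n : ℝ) + 2 ≠ 0 := by positivity
  have : 2 * (n : ℝ) + 3 ≠ 0 := by positivity
  have : (n : ℝ) + 1 + 1 ≠ 0 := by positivity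
  simp [legendrePrim] at h4 ⊢
  field_simp
  linear_combination -h4

lemma intervalIntegrable_poly (p : ℝ[X]) (a b : ℝ) :
    IntervalIntegrable (fun t => p.eval t) volume a b := p.continuous.intervalIntegrable a b

/-- Integration by parts against `P_{n+1}`; the boundary terms vanish. -/
lemma integral_mul_legendrePoly {h h' : ℝ → ℝ} (hc : ContinuousOn h (Icc (-1) 1))
    (hd : ∀ t ∈ Ioo (-1 : ℝ) 1, HasDerivAt h (h' t) t)
    (hi : IntervalIntegrable h' volume (-1) 1) (n : ℕ) :
    ∫ t in (-1 : ℝ)..1, h t * (legendrePoly (n + 1)).eval t =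
      1 / (2 * (n : ℝ) + 3) * ((∫ t in (-1 : ℝ)..1, h' t * (legendrePoly n).eval t) -
        ∫ t in (-1 : ℝ)..1, h' t * (legendrePoly (n + 2)).eval t) := by
  have key := intervalIntegral.integral_mul_deriv_eq_deriv_mul_of_hasDerivAt (a := -1) (b := 1)
    (u := h) (v := fun t => (legendrePrim (n + 1)).eval t) (u' := h')
    (v' := fun t => (legendrePoly (n + 1)).eval t) (by simpa using hc)
    (Polynomial.continuousOn _) (by simpa using hd)
    (fun t _ => by
      rw [← derivative_legendrePrim (Nat.succ_pos n)]
      exact Polynomial.hasDerivAt _ t) hi (intervalIntegrable_poly _ _ _)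
  rw [key, legendrePrim_eval_one, legendrePrim_eval_neg_one]
  have hi' : ∀ k, IntervalIntegrable (fun t => h' t * (legendrePoly k).eval t) volume (-1) 1 :=
    fun k => hi.mul_continuousOn (Polynomial.continuousOn _)
  rw [← intervalIntegral.integral_sub (hi' _) (hi' _), ← intervalIntegral.integral_const_mul,
    mul_zero, mul_zero, sub_zero, zero_sub, ← intervalIntegral.integral_neg]
  congr 1
  ext t
  rw [legendrePrim_succ_eq]
  simp
  ring

lemma integral_poly_mul_legendrePoly (p : ℝ[X]) (n : ℕ) :
    ∫ t in (-1 : ℝ)..1, p.eval t * (legendrePoly (n + 1)).eval t =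
      1 / (2 * (n : ℝ) + 3) * ((∫ t in (-1 : ℝ)..1,
        (derivative p).eval t * (legendrePoly n).eval t) -
        ∫ t in (-1 : ℝ)..1, (derivative p).eval t * (legendrePoly (n + 2)).eval t) :=
  integral_mul_legendrePoly p.continuousOn (fun t _ => p.hasDerivAt t)
    (intervalIntegrable_poly _ _ _) n

lemma integral_mul_legendrePoly_of_degree_lt (d : ℕ) :
    ∀ (p : ℝ[X]) (n : ℕ), p.degree < d → d ≤ n →
      ∫ t in (-1 : ℝ)..1, p.eval t * (legendrePoly n).eval t = 0 := by
  induction d with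
  | zero =>
    intro p n hp _
    have : p = 0 := by simpa using hp
    simp [this]
  | succ d ih =>
    intro p n hp hn
    obtain ⟨k, rfl⟩ : ∃ k, n = k + 1 := ⟨n - 1, by omega⟩
    have hp' : (derivative p).degree < d := by
      by_cases h0 : p = 0
      · simp [h0]
      · by_cases h1 : derivative p = 0
        · simp [h1]
        have h2 : p.natDegree ≠ 0 := fun h => h1 (by
          rw [eq_C_of_natDegree_eq_zero h]; simp)
        have h3 := natDegree_derivative_lt h2
        rw [degree_eq_natDegree h1]
        rw [degree_eq_natDegree h0] at hp
        have h4 : p.natDegree < d + 1 := by exact_mod_cast hp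
        exact_mod_cast (by omega : (derivative p).natDegree < d)
    rw [integral_poly_mul_legendrePoly, ih _ _ hp' (by omega), ih _ _ hp' (by omega)]
    simp

lemma integral_legendrePoly_mul_of_ne {k n : ℕ} (h : k ≠ n) :
    ∫ t in (-1 : ℝ)..1, (legendrePoly k).eval t * (legendrePoly n).eval t = 0 := by
  have main : ∀ {k n : ℕ}, k < n →
      ∫ t in (-1 : ℝ)..1, (legendrePoly k).eval t * (legendrePoly n).eval t = 0 := by
    intro k n h
    refine integral_mul_legendrePoly_of_degree_lt n _ n ?_ le_rfl
    rw [degree_eq_natDegree (legendrePoly_ne_zero k), natDegree_legendrePoly]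
    exact_mod_cast h
  rcases lt_or_gt_of_ne h with h | h
  · exact main h
  · simpa only [mul_comm] using main h

lemma integral_legendrePoly_sq (n : ℕ) :
    ∫ t in (-1 : ℝ)..1, (legendrePoly n).eval t * (legendrePoly n).eval t = 2 / (2 * n + 1) := by
  induction n with
  | zero => simp [legendrePoly_zero]; norm_num
  | succ n ih =>
    have hlow : (derivative (legendrePoly (n + 1))).degree < (n + 2 : ℕ) := by
      refine (degree_derivative_le).trans_lt ?_
      rw [degree_eq_natDegree (legendrePoly_ne_zero _), natDegree_legendrePoly]
      exact_mod_cast Nat.lt_succ_self _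
    rw [integral_poly_mul_legendrePoly, integral_mul_legendrePoly_of_degree_lt _ _ _ hlow le_rfl]
    have h2 : ∫ t in (-1 : ℝ)..1, (derivative (legendrePoly (n + 1))).eval t *
        (legendrePoly n).eval t = 2 := by
      rcases n with _ | n
      · simp [legendrePoly_zero, legendrePoly_one]; norm_num
      · have hlow' : (derivative (legendrePoly n)).degree < (n + 1 : ℕ) := by
          refine (degree_derivative_le).trans_lt ?_
          rw [degree_eq_natDegree (legendrePoly_ne_zero _), natDegree_legendrePoly]
          exact_mod_cast Nat.lt_succ_self _
        rw [derivative_legendrePoly_sub]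
        have hsplit : ∀ t, (derivative (legendrePoly n) +
            (2 * (n : ℝ[X]) + 3) * legendrePoly (n + 1)).eval t * (legendrePoly (n + 1)).eval t =
            (derivative (legendrePoly n)).eval t * (legendrePoly (n + 1)).eval t +
            (2 * (n : ℝ) + 3) *
              ((legendrePoly (n + 1)).eval t * (legendrePoly (n + 1)).eval t) := fun t => by
          simp
          ring
        simp only [hsplit]
        rw [intervalIntegral.integral_add
          (by exact Continuous.intervalIntegrable (by fun_prop) _ _)
          (by exact Continuous.intervalIntegrable (by fun_prop) _ _),
          intervalIntegral.integral_const_mul, ih,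
          integral_mul_legendrePoly_of_degree_lt _ _ _ hlow' le_rfl]
        push_cast
        field_simp
        ring
    rw [h2]
    push_cast
    field_simp
    ring

/-- A polynomial whose derivative is `-x` times a nonnegative one is largest at `0`. -/
lemma le_eval_zero_of_derivative {S R : ℝ[X]} {x : ℝ} (hS : derivative S = -(X * R))
    (hR : ∀ y, 0 ≤ R.eval y) : S.eval x ≤ S.eval 0 := by
  rcases le_total 0 x with hx | hx
  · refine antitoneOn_of_deriv_nonpos (convex_Ici 0) S.continuousOn
      S.differentiable.differentiableOn (fun y hy => ?_) (self_mem_Ici) hx hx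
    rw [interior_Ici] at hy
    rw [Polynomial.deriv, hS]
    simpa using mul_nonneg (le_of_lt hy) (hR y)
  · refine monotoneOn_of_deriv_nonneg (convex_Iic 0) S.continuousOn
      S.differentiable.differentiableOn (fun y hy => ?_) hx (self_mem_Iic) hx
    rw [interior_Iic] at hy
    rw [Polynomial.deriv, hS]
    simpa using mul_nonpos_of_nonpos_of_nonneg (le_of_lt hy) (hR y)

/-- The size of the Legendre polynomials at the origin; by parity one of the two terms vanishes. -/
lemma legendrePoly_eval_zero_sq (n : ℕ) :
    ((n : ℝ) + 1) * (legendrePoly n).eval 0 ^ 2 +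
      ((n : ℝ) + 2) * (legendrePoly (n + 1)).eval 0 ^ 2 ≤ 1 := by
  induction n with
  | zero => simp [legendrePoly_zero, legendrePoly_one]
  | succ n ih =>
    have e := congrArg (eval 0) (legendrePoly_three_term n)
    simp at e
    have hn : (0 : ℝ) < (n : ℝ) + 2 := by positivity
    have e' : (legendrePoly (n + 2)).eval 0 =
        -(((n : ℝ) + 1) / (n + 2)) * (legendrePoly n).eval 0 := by
      field_simp
      linarith
    have h3 : ((n : ℝ) + 3) * (((n : ℝ) + 1) / (n + 2)) ^ 2 ≤ n + 1 := by
      rw [div_pow, ← mul_div_assoc, div_le_iff₀ (by positivity)]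
      have : (0 : ℝ) ≤ n := by positivity
      nlinarith
    have h4 := mul_le_mul_of_nonneg_right h3 (sq_nonneg ((legendrePoly n).eval 0))
    show ((n + 1 : ℕ) + 1 : ℝ) * (legendrePoly (n + 1)).eval 0 ^ 2 +
      ((n + 1 : ℕ) + 2 : ℝ) * (legendrePoly (n + 2)).eval 0 ^ 2 ≤ 1
    rw [e']
    push_cast
    nlinarith

/-- `|W_n| ≤ 1 / (√n (n + 1))` on `[-1, 1]` for the primitive `W_n` of `P_n`. As
`(1 - x²) W'' + n (n + 1) W = 0`, Sonine's function `W² + (1 - x²) W'² / (n (n + 1))` is largest at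
the origin, where the three-term recurrence gives its size. -/
lemma abs_legendrePrim_le (n : ℕ) {x : ℝ} (hx : x ∈ Icc (-1 : ℝ) 1) :
    |(legendrePrim (n + 1)).eval x| ≤ 1 / (√((n : ℝ) + 1) * ((n : ℝ) + 2)) := by
  set c : ℝ := 1 / (((n : ℝ) + 1) * (n + 2)) with hc
  have hc0 : 0 < c := by positivity
  have hW : legendrePrim (n + 1) =
      C (-c) * ((1 - X ^ 2) * derivative (legendrePoly (n + 1))) := by
    rw [legendrePrim, hc]
    congr 2
    push_cast
    rw [neg_div]
    ring_nf
  have hd : derivative (legendrePrim (n + 1)) = legendrePoly (n + 1) :=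
    derivative_legendrePrim (Nat.succ_pos n)
  have hS : derivative (legendrePrim (n + 1) ^ 2 +
      C c * ((1 - X ^ 2) * legendrePoly (n + 1) ^ 2)) =
      -(X * (C (2 * c) * legendrePoly (n + 1) ^ 2)) := by
    simp only [derivative_add, derivative_mul, derivative_sub, derivative_one,
      derivative_pow, hd]
    rw [hW]
    simp
    ring
  have key := le_eval_zero_of_derivative (x := x) hS fun y => by
    simp only [eval_mul, eval_C, eval_pow]
    positivity
  have e0 : (legendrePrim (n + 1)).eval 0 = -(1 / ((n : ℝ) + 2)) * (legendrePoly n).eval 0 := by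
    have h1 := congrArg (eval 0) (one_sub_sq_mul_derivative_legendrePoly n)
    rw [hW]
    simp at h1 ⊢
    rw [h1, hc]
    field_simp
  have hb := legendrePoly_eval_zero_sq n
  have hsq : (legendrePrim (n + 1)).eval x ^ 2 ≤ 1 / (((n : ℝ) + 1) * ((n : ℝ) + 2) ^ 2) := by
    have h1 : 0 ≤ c * ((1 - x ^ 2) * (legendrePoly (n + 1)).eval x ^ 2) := by
      have : 0 ≤ 1 - x ^ 2 := by nlinarith [hx.1, hx.2]
      positivity
    simp [e0] at key
    have h2 : (((n : ℝ) + 2)⁻¹ * (legendrePoly n).eval 0) ^ 2 +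
        c * (legendrePoly (n + 1)).eval 0 ^ 2 =
        (((n : ℝ) + 1) * (legendrePoly n).eval 0 ^ 2 +
      ((n : ℝ) + 2) * (legendrePoly (n + 1)).eval 0 ^ 2) *
        (1 / (((n : ℝ) + 1) * ((n : ℝ) + 2) ^ 2)) := by
      rw [hc]
      field_simp
    rw [h2] at key
    have h3 := mul_le_mul_of_nonneg_right hb
      (by positivity : (0 : ℝ) ≤ 1 / (((n : ℝ) + 1) * ((n : ℝ) + 2) ^ 2))
    linarith
  apply abs_le_of_sq_le_sq _ (by positivity)
  refine hsq.trans (le_of_eq ?_)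
  rw [div_pow, mul_pow, Real.sq_sqrt (by positivity), one_pow]

/-- `|P_n| ≤ 1` on `[-1, 1]`: the function `P² + (1 - x²) P'² / (n (n + 1))` decreases towards the
origin, and equals `1` at `±1`. -/
lemma abs_legendrePoly_le_one (n : ℕ) {x : ℝ} (hx : x ∈ Icc (-1 : ℝ) 1) :
    |(legendrePoly n).eval x| ≤ 1 := by
  rcases n with _ | n
  · simp [legendrePoly_zero]
  set c : ℝ := 1 / (((n : ℝ) + 1) * (n + 2)) with hc
  have hc0 : 0 < c := by positivity
  set P := legendrePoly (n + 1) with hP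
  set S : ℝ[X] := P ^ 2 + C c * ((1 - X ^ 2) * derivative P ^ 2) with hS
  have hode : (1 - X ^ 2) * derivative (derivative P) =
      2 * X * derivative P - C (((n : ℝ) + 1) * (n + 2)) * P := by
    have := legendrePoly_ode (n + 1)
    rw [derivative_mul] at this
    simp [C_ofNat] at this ⊢
    linear_combination this
  have hcc : C c * C (((n : ℝ) + 1) * (n + 2)) = 1 := by
    rw [← C_mul, hc, one_div_mul_cancel (by positivity), C_1]
  have hdS : derivative S = X * (C (2 * c) * derivative P ^ 2) := by
    rw [hS]
    simp only [derivative_add, derivative_mul, derivative_sub, derivative_one,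
      derivative_pow, C_mul]
    simp [C_ofNat]
    simp [C_ofNat] at hode hcc
    linear_combination 2 * C c * derivative P * hode - 2 * P * derivative P * hcc
  have hsq : S.eval x ≤ 1 := by
    rcases le_total 0 x with h0 | h0
    · have : S.eval x ≤ S.eval 1 := by
        refine monotoneOn_of_deriv_nonneg (convex_Ici 0) S.continuousOn
          S.differentiable.differentiableOn (fun y hy => ?_) h0 (mem_Ici.2 zero_le_one) hx.2
        rw [interior_Ici] at hy
        rw [Polynomial.deriv, hdS]
        have : 0 < y := hy
        simp only [eval_mul, eval_X, eval_C, eval_pow]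
        positivity
      refine this.trans (le_of_eq ?_)
      simp [hS, hP, legendrePoly_eval_one]
    · have : S.eval x ≤ S.eval (-1) := by
        refine antitoneOn_of_deriv_nonpos (convex_Iic 0) S.continuousOn
          S.differentiable.differentiableOn (fun y hy => ?_)
          (mem_Iic.2 (by norm_num)) h0 hx.1
        rw [interior_Iic] at hy
        rw [Polynomial.deriv, hdS]
        have : y < 0 := hy
        simp only [eval_mul, eval_X, eval_C, eval_pow]
        exact mul_nonpos_of_nonpos_of_nonneg this.le (by positivity)
      refine this.trans (le_of_eq ?_)
      simp [hS, hP, legendrePoly_eval_one, legendrePoly_eval_neg, ← pow_mul, mul_comm _ 2]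
  have h1 : 0 ≤ c * ((1 - x ^ 2) * (derivative P).eval x ^ 2) := by
    have : 0 ≤ 1 - x ^ 2 := by nlinarith [hx.1, hx.2]
    positivity
  simp [hS] at hsq
  rw [← sq_le_one_iff_abs_le_one]
  linarith

/-! ### Functions of bounded variation and their Legendre coefficients -/

lemma _root_.BoundedVariationOn.intervalIntegrable_Icc {φ : ℝ → ℝ}
    (hφ : BoundedVariationOn φ (Icc (-1) 1)) {a b : ℝ} (ha : a ∈ Icc (-1 : ℝ) 1)
    (hb : b ∈ Icc (-1 : ℝ) 1) : IntervalIntegrable φ volume a b := by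
  obtain ⟨p, q, hp, hq, rfl⟩ := hφ.locallyBoundedVariationOn.exists_monotoneOn_sub_monotoneOn
  have h : uIcc a b ⊆ Icc (-1) 1 := uIcc_subset_Icc ha hb
  exact (hp.mono h).intervalIntegrable.sub (hq.mono h).intervalIntegrable

lemma abs_integral_le_of_abs_le {φ : ℝ → ℝ} {a b C : ℝ} (hab : a ≤ b)
    (h : ∀ y ∈ Icc a b, |φ y| ≤ C) : |∫ y in a..b, φ y| ≤ C * (b - a) := by
  have := intervalIntegral.norm_integral_le_of_norm_le_const (a := a) (b := b) (f := φ) (C := C)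
    fun y hy => h y (by rw [uIoc_of_le hab] at hy; exact Ioc_subset_Icc_self hy)
  rwa [abs_of_nonneg (sub_nonneg.2 hab)] at this

/-- One step of the integration by parts for functions of bounded variation: on a short interval
`∫ φ W'` differs from the boundary terms by at most the variation of `φ` times nearly `sup |W|`. -/
lemma abs_integral_mul_deriv_sub_le {φ v W W' : ℝ → ℝ} {M K s t : ℝ} (hst : s ≤ t)
    (hv : ∀ y ∈ Icc s t, |φ y - φ s| ≤ v t - v s)
    (hφ : IntervalIntegrable φ volume s t)
    (hW : ∀ y, HasDerivAt W (W' y) y) (hW' : Continuous W')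
    (hM : |W t| ≤ M) (hK : ∀ y ∈ Icc s t, |W' y| ≤ K) :
    |(∫ y in s..t, φ y * W' y) - (φ t * W t - φ s * W s)| ≤ (v t - v s) * (M + (t - s) * K) := by
  have hmem : t ∈ Icc s t := right_mem_Icc.2 hst
  have hV0 : 0 ≤ v t - v s := (abs_nonneg _).trans (hv t hmem)
  have hWi := intervalIntegral.integral_eq_sub_of_hasDerivAt (a := s) (b := t) (fun y _ => hW y)
    (hW'.intervalIntegrable _ _)
  have h1 : (∫ y in s..t, φ y * W' y) - (φ t * W t - φ s * W s) =
      (∫ y in s..t, (φ y - φ s) * W' y) - (φ t - φ s) * W t := by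
    simp only [sub_mul]
    rw [intervalIntegral.integral_sub (hφ.mul_continuousOn hW'.continuousOn)
      ((hW'.intervalIntegrable _ _).const_mul _), intervalIntegral.integral_const_mul, hWi]
    ring
  have h2 : |∫ y in s..t, (φ y - φ s) * W' y| ≤ (v t - v s) * K * (t - s) := by
    refine abs_integral_le_of_abs_le hst fun y hy => ?_
    rw [abs_mul]
    exact mul_le_mul (hv y hy) (hK y hy) (abs_nonneg _) hV0
  rw [h1]
  refine (abs_sub _ _).trans ?_
  rw [abs_mul (φ t - φ s)]
  have h3 := mul_le_mul (hv t hmem) hM (abs_nonneg _) hV0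
  linarith

/-- If `φ` has bounded variation and `W(±1) = 0`, then `|∫ φ W'| ≤ Var(φ) sup |W|`. -/
lemma _root_.BoundedVariationOn.abs_integral_mul_deriv_le {φ W W' : ℝ → ℝ}
    (hφ : BoundedVariationOn φ (Icc (-1) 1)) (hW : ∀ y, HasDerivAt W (W' y) y)
    (hW' : Continuous W') {M : ℝ} (hM : ∀ y ∈ Icc (-1 : ℝ) 1, |W y| ≤ M)
    (h1 : W (-1) = 0) (h2 : W 1 = 0) :
    |∫ y in (-1 : ℝ)..1, φ y * W' y| ≤ (eVariationOn φ (Icc (-1) 1)).toReal * M := by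
  obtain ⟨K, hK⟩ := isCompact_Icc.exists_bound_of_continuousOn (s := Icc (-1 : ℝ) 1)
    hW'.continuousOn
  set V := (eVariationOn φ (Icc (-1) 1)).toReal
  set v := variationOnFromTo φ (Icc (-1) 1) (-1)
  have hl := hφ.locallyBoundedVariationOn
  have hm1 : (-1 : ℝ) ∈ Icc (-1 : ℝ) 1 := by simp
  have hv1 : v (-1) = 0 := variationOnFromTo.self _ _ _
  have hv2 : v 1 = V := by
    simp only [v, V]
    rw [variationOnFromTo.eq_of_le _ _ (by norm_num), inter_self]
  have hvm : MonotoneOn v (Icc (-1) 1) := variationOnFromTo.monotoneOn hl hm1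
  -- the bound along the partition of `[-1, 1]` into `n` intervals of equal length
  have key : ∀ n : ℕ, 0 < n →
      |∫ y in (-1 : ℝ)..1, φ y * W' y| ≤ V * (M + 2 / n * K) := by
    intro n hn
    have hn' : (0 : ℝ) < n := by exact_mod_cast hn
    set a : ℕ → ℝ := fun i => -1 + 2 * i / n
    have ha0 : a 0 = -1 := by simp [a]
    have han : a n = 1 := by simp only [a]; field_simp; norm_num
    have hstep : ∀ i, a (i + 1) - a i = 2 / n := fun i => by
      simp only [a]
      push_cast
      field_simp
      ring
    have hmono : Monotone a := monotone_nat_of_le_succ fun i => by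
      have := hstep i
      have : 0 < 2 / (n : ℝ) := by positivity
      linarith
    have hmem : ∀ i ≤ n, a i ∈ Icc (-1 : ℝ) 1 := fun i hi =>
      ⟨ha0 ▸ hmono (Nat.zero_le i), han ▸ hmono hi⟩
    have hint : ∀ i < n, IntervalIntegrable (fun y => φ y * W' y) volume (a i) (a (i + 1)) :=
      fun i hi => (hφ.intervalIntegrable_Icc (hmem i hi.le) (hmem _ hi)).mul_continuousOn
        hW'.continuousOn
    have hsum := intervalIntegral.sum_integral_adjacent_intervals hint
    have htel : ∑ i ∈ Finset.range n, (φ (a (i + 1)) * W (a (i + 1)) - φ (a i) * W (a i)) = 0 := by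
      rw [Finset.sum_range_sub (fun i => φ (a i) * W (a i)), ha0, han, h1, h2]
      ring
    rw [ha0, han] at hsum
    rw [← hsum, ← sub_zero (∑ _ ∈ _, _), ← htel, ← Finset.sum_sub_distrib]
    calc _ ≤ ∑ i ∈ Finset.range n, |(∫ y in (a i)..(a (i + 1)), φ y * W' y) -
          (φ (a (i + 1)) * W (a (i + 1)) - φ (a i) * W (a i))| := Finset.abs_sum_le_sum_abs _ _
      _ ≤ ∑ i ∈ Finset.range n, (v (a (i + 1)) - v (a i)) * (M + 2 / n * K) := by
          refine Finset.sum_le_sum fun i hi => ?_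
          have hi := Finset.mem_range.1 hi
          have hle : a i ≤ a (i + 1) := hmono (Nat.le_succ i)
          have hs := hmem i hi.le
          have ht := hmem (i + 1) hi
          rw [← hstep i]
          refine abs_integral_mul_deriv_sub_le hle (fun y hy => ?_)
            (hφ.intervalIntegrable_Icc hs ht) hW hW' (hM _ ht)
            (fun y hy => hK y ⟨hs.1.trans hy.1, hy.2.trans ht.2⟩)
          have hy' : y ∈ Icc (-1 : ℝ) 1 := ⟨hs.1.trans hy.1, hy.2.trans ht.2⟩
          have := variationOnFromTo.abs_sub_le_sub_of_le hl hm1 hs hy' hy.1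
          have := hvm hy' ht hy.2
          simp only [v] at *
          linarith
      _ = V * (M + 2 / n * K) := by
          rw [← Finset.sum_mul, Finset.sum_range_sub (fun i => v (a i)), ha0, han, hv1, hv2,
            sub_zero]
  have hlim : Filter.Tendsto (fun n : ℕ => V * (M + 2 / n * K)) Filter.atTop
      (nhds (V * (M + 0 * K))) :=
    (((tendsto_const_div_atTop_nhds_zero_nat 2).mul_const K).const_add M).const_mul V
  rw [zero_mul, add_zero] at hlim
  exact ge_of_tendsto hlim (Filter.eventually_atTop.2 ⟨1, fun n hn => key n hn⟩)

lemma _root_.BoundedVariationOn.abs_integral_mul_legendrePoly_le {φ : ℝ → ℝ}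
    (hφ : BoundedVariationOn φ (Icc (-1) 1)) (n : ℕ) :
    |∫ y in (-1 : ℝ)..1, φ y * (legendrePoly (n + 1)).eval y| ≤
      (eVariationOn φ (Icc (-1) 1)).toReal * (1 / (√((n : ℝ) + 1) * ((n : ℝ) + 2))) := by
  refine hφ.abs_integral_mul_deriv_le (W := fun y => (legendrePrim (n + 1)).eval y) (fun y => ?_)
    (Polynomial.continuous _)
    (fun y hy => abs_legendrePrim_le n hy) (legendrePrim_eval_neg_one _) (legendrePrim_eval_one _)
  rw [← derivative_legendrePrim (Nat.succ_pos n)]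
  exact Polynomial.hasDerivAt _ y

lemma rpow_three_halves {x : ℝ} (hx : 0 ≤ x) : x ^ (3 / 2 : ℝ) = x * √x := by
  rcases hx.eq_or_lt with rfl | hx
  · rw [Real.zero_rpow (by norm_num)]; simp
  · rw [show (3 / 2 : ℝ) = 1 + 1 / 2 by norm_num, Real.rpow_add hx, Real.rpow_one,
      ← Real.sqrt_eq_rpow]

lemma two_le_six_div_sqrt_pi : (2 : ℝ) ≤ 6 / √Real.pi := by
  rw [le_div_iff₀ (Real.sqrt_pos.2 Real.pi_pos)]
  have : √Real.pi ≤ 2 := by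
    rw [Real.sqrt_le_left (by norm_num)]
    linarith [Real.pi_lt_four]
  linarith

/-- The Legendre coefficients of a function whose derivative has bounded variation. -/
lemma abs_legendreCoeff_succ_le {h h' : ℝ → ℝ} (hc : ContinuousOn h (Icc (-1) 1))
    (hd : ∀ t ∈ Ioo (-1 : ℝ) 1, HasDerivAt h (h' t) t)
    (hV : BoundedVariationOn h' (Icc (-1) 1)) {U : ℝ} (hU : ∀ t ∈ Icc (-1 : ℝ) 1, |h' t| ≤ U)
    (n : ℕ) :
    |legendreCoeff h (n + 1)| ≤
      6 / √Real.pi * (U + (eVariationOn h' (Icc (-1) 1)).toReal) *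
        (1 / ((n : ℝ) + 1) ^ (3 / 2 : ℝ)) := by
  set V := (eVariationOn h' (Icc (-1) 1)).toReal
  have hV0 : 0 ≤ V := ENNReal.toReal_nonneg
  have hU0 : 0 ≤ U := (abs_nonneg _).trans (hU 0 (by simp))
  set s : ℝ := 1 / ((n : ℝ) + 1) ^ (3 / 2 : ℝ) with hs
  have hs0 : 0 ≤ s := by positivity
  have hs' : s = 1 / (((n : ℝ) + 1) * √((n : ℝ) + 1)) := by
    rw [hs, rpow_three_halves (by positivity)]
  have hi : IntervalIntegrable h' volume (-1) 1 :=
    hV.intervalIntegrable_Icc (by simp) (by simp)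
  have e : legendreCoeff h (n + 1) = 1 / 2 * ((∫ t in (-1 : ℝ)..1, h' t * (legendrePoly n).eval t) -
        ∫ t in (-1 : ℝ)..1, h' t * (legendrePoly (n + 2)).eval t) := by
    rw [legendreCoeff, integral_mul_legendrePoly hc hd hi]
    push_cast
    field_simp
    ring
  have hsq : 0 < √((n : ℝ) + 1) := Real.sqrt_pos.2 (by positivity)
  -- both neighbouring integrals are at most `2 (U + V) (n + 1)^(-3/2)`
  have b2 : |∫ t in (-1 : ℝ)..1, h' t * (legendrePoly (n + 2)).eval t| ≤ 2 * (U + V) * s := by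
    refine (hV.abs_integral_mul_legendrePoly_le (n + 1)).trans ?_
    have : 1 / (√(((n + 1 : ℕ) : ℝ) + 1) * (((n + 1 : ℕ) : ℝ) + 2)) ≤ s := by
      rw [hs']
      apply one_div_le_one_div_of_le (by positivity)
      rw [mul_comm √(((n + 1 : ℕ) : ℝ) + 1)]
      push_cast
      apply mul_le_mul (by linarith) (Real.sqrt_le_sqrt (by linarith)) hsq.le (by positivity)
    refine (mul_le_mul_of_nonneg_left this hV0).trans (mul_le_mul_of_nonneg_right ?_ hs0)
    linarith
  have b1 : |∫ t in (-1 : ℝ)..1, h' t * (legendrePoly n).eval t| ≤ 2 * (U + V) * s := by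
    rcases n with _ | k
    · have : |∫ t in (-1 : ℝ)..1, h' t * (legendrePoly 0).eval t| ≤ U * (1 - (-1)) := by
        refine abs_integral_le_of_abs_le (by norm_num) fun y hy => ?_
        simpa [legendrePoly_zero] using hU y hy
      rw [hs'] at *
      norm_num at this ⊢
      linarith
    · refine (hV.abs_integral_mul_legendrePoly_le k).trans ?_
      have : 1 / (√((k : ℝ) + 1) * ((k : ℝ) + 2)) ≤ 2 * s := by
        rw [hs', mul_one_div, div_le_div_iff₀ (by positivity) (by positivity)]
        have h4 : √((k : ℝ) + 1 + 1) ≤ 2 * √((k : ℝ) + 1) := by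
          rw [Real.sqrt_le_left (by positivity), mul_pow, Real.sq_sqrt (by positivity)]
          have : (0 : ℝ) ≤ k := by positivity
          linarith
        push_cast
        have : (0 : ℝ) ≤ (k : ℝ) + 1 + 1 := by positivity
        nlinarith [mul_le_mul_of_nonneg_left h4 this]
      calc V * (1 / (√((k : ℝ) + 1) * ((k : ℝ) + 2))) ≤ (U + V) * (2 * s) :=
            mul_le_mul (by linarith) this (by positivity) (by linarith)
        _ = _ := by ring
  rw [e, abs_mul, abs_of_pos (by norm_num : (0 : ℝ) < 1 / 2)]
  have h3 := abs_sub (∫ t in (-1 : ℝ)..1, h' t * (legendrePoly n).eval t)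
    (∫ t in (-1 : ℝ)..1, h' t * (legendrePoly (n + 2)).eval t)
  have h4 : 2 * ((U + V) * s) ≤ 6 / √Real.pi * ((U + V) * s) :=
    mul_le_mul_of_nonneg_right two_le_six_div_sqrt_pi (by positivity)
  calc _ ≤ 2 * ((U + V) * s) := by linarith
    _ ≤ _ := by rw [mul_assoc]; exact h4

/-- If `H 0, …, H q` are successive derivatives and the last one has bounded variation, then
`∫ H 0 P_n = O(n^{-q-3/2})`. -/
lemma exists_integral_mul_legendrePoly_le (q : ℕ) : ∀ (H : ℕ → ℝ → ℝ),
    (∀ k < q, ContinuousOn (H k) (Icc (-1) 1)) →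
    (∀ k < q, ∀ t ∈ Ioo (-1 : ℝ) 1, HasDerivAt (H k) (H (k + 1) t) t) →
    BoundedVariationOn (H q) (Icc (-1) 1) →
    ∃ C : ℝ, ∀ n : ℕ, |∫ t in (-1 : ℝ)..1, H 0 t * (legendrePoly n).eval t| ≤
      C / (((n : ℝ) + 1) ^ (q + 1) * √((n : ℝ) + 1)) := by
  induction q with
  | zero =>
    intro H _ _ hV
    set V := (eVariationOn (H 0) (Icc (-1) 1)).toReal
    set I := |∫ t in (-1 : ℝ)..1, H 0 t * (legendrePoly 0).eval t|
    have hV0 : 0 ≤ V := ENNReal.toReal_nonneg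
    have hI0 : 0 ≤ I := abs_nonneg _
    refine ⟨2 * V + I, fun n => ?_⟩
    rcases n with _ | n
    · simp
      linarith
    · refine (hV.abs_integral_mul_legendrePoly_le n).trans ?_
      have h4 : √((n : ℝ) + 1 + 1) ≤ 2 * √((n : ℝ) + 1) := by
        rw [Real.sqrt_le_left (by positivity), mul_pow, Real.sq_sqrt (by positivity)]
        have : (0 : ℝ) ≤ n := by positivity
        linarith
      have hsq : 0 < √((n : ℝ) + 1) := Real.sqrt_pos.2 (by positivity)
      rw [mul_one_div]
      push_cast
      rw [pow_one, div_le_div_iff₀ (by positivity) (by positivity)]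
      have : (0 : ℝ) ≤ (n : ℝ) + 1 + 1 := by positivity
      calc V * (((n : ℝ) + 1 + 1) * √((n : ℝ) + 1 + 1))
          ≤ V * (((n : ℝ) + 1 + 1) * (2 * √((n : ℝ) + 1))) := by gcongr
        _ = (2 * V) * (√((n : ℝ) + 1) * ((n : ℝ) + 2)) := by ring
        _ ≤ _ := by gcongr; linarith
  | succ q ih =>
    intro H hc hd hV
    obtain ⟨C, hC⟩ := ih (fun k => H (k + 1)) (fun k hk => hc (k + 1) (by omega))
      (fun k hk => hd (k + 1) (by omega)) hV
    set I := |∫ t in (-1 : ℝ)..1, H 0 t * (legendrePoly 0).eval t|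
    have hI0 : 0 ≤ I := abs_nonneg _
    have hC0 : 0 ≤ C := by
      have := (abs_nonneg _).trans (hC 0)
      simpa using this
    have hi : IntervalIntegrable (H 1) volume (-1) 1 := by
      rcases q with _ | q
      · exact hV.intervalIntegrable_Icc (by simp) (by simp)
      · exact ContinuousOn.intervalIntegrable_of_Icc (by norm_num) (hc 1 (by omega))
    refine ⟨2 ^ (q + 3) * C + I, fun n => ?_⟩
    rcases n with _ | n
    · have : 0 ≤ 2 ^ (q + 3) * C := by positivity
      simp only [Nat.cast_zero, zero_add, one_pow, Real.sqrt_one, mul_one, div_one]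
      linarith
    rw [integral_mul_legendrePoly (hc 0 (by omega)) (hd 0 (by omega)) hi]
    have h1 := hC n
    have h2 := hC (n + 2)
    rw [zero_add] at h1 h2
    have hsq : 0 < √((n : ℝ) + 1) := Real.sqrt_pos.2 (by positivity)
    have h2' : C / ((((n + 2 : ℕ) : ℝ) + 1) ^ (q + 1) * √(((n + 2 : ℕ) : ℝ) + 1)) ≤
        C / (((n : ℝ) + 1) ^ (q + 1) * √((n : ℝ) + 1)) := by
      push_cast
      gcongr <;> linarith
    have h3 := abs_sub (∫ t in (-1 : ℝ)..1, H 1 t * (legendrePoly n).eval t)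
      (∫ t in (-1 : ℝ)..1, H 1 t * (legendrePoly (n + 2)).eval t)
    have h4 : √((n : ℝ) + 1 + 1) ≤ 2 * √((n : ℝ) + 1) := by
      rw [Real.sqrt_le_left (by positivity), mul_pow, Real.sq_sqrt (by positivity)]
      have : (0 : ℝ) ≤ n := by positivity
      linarith
    have h5 : ((n : ℝ) + 1 + 1) ^ (q + 1) ≤ 2 ^ (q + 1) * ((n : ℝ) + 1) ^ (q + 1) := by
      rw [← mul_pow]
      gcongr
      have : (0 : ℝ) ≤ n := by positivity
      linarith
    have h6 : C / (((n : ℝ) + 1) ^ (q + 1) * √((n : ℝ) + 1)) ≤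
        2 ^ (q + 2) * C / (((n : ℝ) + 1 + 1) ^ (q + 1) * √((n : ℝ) + 1 + 1)) := by
      rw [div_le_div_iff₀ (by positivity) (by positivity)]
      calc C * (((n : ℝ) + 1 + 1) ^ (q + 1) * √((n : ℝ) + 1 + 1))
          ≤ C * ((2 ^ (q + 1) * ((n : ℝ) + 1) ^ (q + 1)) * (2 * √((n : ℝ) + 1))) := by gcongr
        _ = _ := by ring
    rw [abs_mul, abs_of_pos (by positivity : (0 : ℝ) < 1 / (2 * (n : ℝ) + 3))]
    push_cast
    set D := 2 ^ (q + 2) * C / (((n : ℝ) + 1 + 1) ^ (q + 1) * √((n : ℝ) + 1 + 1)) with hD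
    have hD0 : 0 ≤ D := by positivity
    calc _ ≤ 1 / ((n : ℝ) + 1 + 1) * (2 * D) := by
          apply mul_le_mul _ (by linarith) (abs_nonneg _) (by positivity)
          apply one_div_le_one_div_of_le (by positivity)
          have : (0 : ℝ) ≤ n := by positivity
          linarith
      _ = 2 ^ (q + 3) * C / (((n : ℝ) + 1 + 1) ^ (q + 1 + 1) * √((n : ℝ) + 1 + 1)) := by
          rw [hD]
          field_simp
          ring
      _ ≤ _ := by gcongr; linarith

/-! ### Legendre expansions -/

/-- Orthogonality to the first `d` Legendre polynomials implies orthogonality to all polynomials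
of degree less than `d`. -/
lemma integral_mul_poly_eq_zero {k : ℝ → ℝ} (hk : ContinuousOn k (Icc (-1) 1)) (d : ℕ)
    (h : ∀ n < d, ∫ t in (-1 : ℝ)..1, k t * (legendrePoly n).eval t = 0) :
    ∀ p : ℝ[X], p.degree < d → ∫ t in (-1 : ℝ)..1, k t * p.eval t = 0 := by
  induction d with
  | zero =>
    intro p hp
    have : p = 0 := by simpa using hp
    simp [this]
  | succ d ih =>
    intro p hp
    have hi : ∀ p : ℝ[X], IntervalIntegrable (fun t => k t * p.eval t) volume (-1) 1 := fun p =>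
      ContinuousOn.intervalIntegrable_of_Icc (by norm_num) (hk.mul p.continuousOn)
    set c := p.coeff d / (legendrePoly d).coeff d with hc
    have hcp := (legendrePoly_coeff d).2.ne'
    have hr : (p - C c * legendrePoly d).degree < d := by
      rw [degree_lt_iff_coeff_zero]
      intro m hm
      rcases hm.eq_or_lt with rfl | hm
      · rw [coeff_sub, coeff_C_mul, hc, div_mul_cancel₀ _ hcp, sub_self]
      · rw [coeff_sub, coeff_C_mul, (degree_lt_iff_coeff_zero _ _).1 hp m hm,
          coeff_eq_zero_of_natDegree_lt ((natDegree_legendrePoly d).trans_lt hm)]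
        simp
    have e : ∀ t, k t * p.eval t = k t * (p - C c * legendrePoly d).eval t +
        c * (k t * (legendrePoly d).eval t) := fun t => by simp; ring
    simp only [e]
    rw [intervalIntegral.integral_add (hi _) ((hi _).const_mul _),
      ih (fun n hn => h n (by omega)) _ hr, intervalIntegral.integral_const_mul, h d (by omega)]
    simp

/-- A continuous function orthogonal to all Legendre polynomials vanishes. -/
lemma eq_zero_of_integral_mul_legendrePoly_eq_zero {k : ℝ → ℝ}
    (hk : ContinuousOn k (Icc (-1) 1))
    (h : ∀ n, ∫ t in (-1 : ℝ)..1, k t * (legendrePoly n).eval t = 0) :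
    ∀ t ∈ Icc (-1 : ℝ) 1, k t = 0 := by
  have hpoly : ∀ p : ℝ[X], ∫ t in (-1 : ℝ)..1, k t * p.eval t = 0 := fun p =>
    integral_mul_poly_eq_zero hk (p.natDegree + 1) (fun n _ => h n) p
      (degree_le_natDegree.trans_lt (by exact_mod_cast Nat.lt_succ_self _))
  obtain ⟨K, hK⟩ := isCompact_Icc.exists_bound_of_continuousOn hk
  have hi2 : IntervalIntegrable (fun t => k t * k t) volume (-1) 1 :=
    ContinuousOn.intervalIntegrable_of_Icc (by norm_num) (hk.mul hk)
  have hsq : ∀ ε > 0, (∫ t in (-1 : ℝ)..1, k t * k t) ≤ K * ε * 2 := by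
    intro ε hε
    obtain ⟨p, hp⟩ := exists_polynomial_near_of_continuousOn (-1) 1 k hk ε hε
    have e : ∫ t in (-1 : ℝ)..1, k t * k t = ∫ t in (-1 : ℝ)..1, k t * (k t - p.eval t) := by
      simp only [mul_sub]
      rw [intervalIntegral.integral_sub hi2
        (ContinuousOn.intervalIntegrable_of_Icc (by norm_num)
          (show ContinuousOn (fun t => k t * p.eval t) _ from hk.mul p.continuousOn)), hpoly,
        sub_zero]
    rw [e]
    refine (le_abs_self _).trans
      ((abs_integral_le_of_abs_le (C := K * ε) (by norm_num) fun y hy => ?_).trans ?_)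
    · rw [abs_mul]
      refine mul_le_mul (hK y hy) ?_ (abs_nonneg _) ((norm_nonneg _).trans (hK y hy))
      rw [abs_sub_comm]
      exact (hp y hy).le
    · norm_num
  have h0 : (∫ t in (-1 : ℝ)..1, k t * k t) ≤ 0 := by
    have hlim : Filter.Tendsto (fun ε : ℝ => K * ε * 2) (nhdsWithin 0 (Ioi 0)) (nhds (K * 0 * 2)) :=
      (((continuous_const.mul continuous_id).mul continuous_const).tendsto 0).mono_left
        nhdsWithin_le_nhds
    have := ge_of_tendsto hlim (Filter.eventually_of_mem self_mem_nhdsWithin fun ε hε => hsq ε hε)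
    simpa using this
  by_contra hne
  push Not at hne
  obtain ⟨t, ht, hkt⟩ := hne
  have hpos : 0 < ∫ t in (-1 : ℝ)..1, k t * k t :=
    intervalIntegral.integral_pos (by norm_num) (hk.mul hk) (fun x _ => mul_self_nonneg _)
      ⟨t, ht, mul_self_pos.2 hkt⟩
  linarith

/-- An absolutely convergent Legendre expansion of a continuous function converges to it
pointwise. -/
lemma hasSum_legendreCoeff {h : ℝ → ℝ} (hc : ContinuousOn h (Icc (-1) 1))
    (hs : Summable fun n => |legendreCoeff h n|) {t : ℝ} (ht : t ∈ Icc (-1 : ℝ) 1) :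
    HasSum (fun n => legendreCoeff h n * (legendrePoly n).eval t) (h t) := by
  set a := legendreCoeff h
  have hb : ∀ n, ∀ t ∈ Icc (-1 : ℝ) 1, ‖a n * (legendrePoly n).eval t‖ ≤ |a n| := by
    intro n t ht
    rw [Real.norm_eq_abs, abs_mul]
    exact mul_le_of_le_one_right (abs_nonneg _) (abs_legendrePoly_le_one n ht)
  have hsum : ∀ t ∈ Icc (-1 : ℝ) 1, Summable fun n => a n * (legendrePoly n).eval t :=
    fun t ht => Summable.of_norm_bounded hs fun n => hb n t ht
  set S : ℝ → ℝ := fun t => ∑' n, a n * (legendrePoly n).eval t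
  have hSc : ContinuousOn S (Icc (-1) 1) :=
    continuousOn_tsum (fun n => (Polynomial.continuousOn _).const_smul (a n)) hs hb
  have hcoef : ∀ m, ∫ t in (-1 : ℝ)..1, S t * (legendrePoly m).eval t =
      a m * (2 / (2 * m + 1)) := by
    intro m
    have h1 := intervalIntegral.hasSum_integral_of_dominated_convergence
      (μ := volume) (a := -1) (b := 1)
      (F := fun n t => a n * (legendrePoly n).eval t * (legendrePoly m).eval t)
      (f := fun t => S t * (legendrePoly m).eval t) (fun n _ => |a n|)
      (fun n => Continuous.aestronglyMeasurable (by fun_prop))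
      (fun n => Filter.Eventually.of_forall fun t ht => by
        rw [uIoc_of_le (by norm_num)] at ht
        have ht' := Ioc_subset_Icc_self ht
        rw [norm_mul]
        exact (mul_le_of_le_one_right (norm_nonneg _) (abs_legendrePoly_le_one m ht')).trans
          (hb n t ht'))
      (Filter.Eventually.of_forall fun t _ => hs) (by simp)
      (Filter.Eventually.of_forall fun t ht => by
        rw [uIoc_of_le (by norm_num)] at ht
        exact (hsum t (Ioc_subset_Icc_self ht)).hasSum.mul_right _)
    have h2 : ∀ n, n ≠ m →
        ∫ t in (-1 : ℝ)..1, a n * (legendrePoly n).eval t * (legendrePoly m).eval t = 0 := by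
      intro n hn
      simp only [mul_assoc]
      rw [intervalIntegral.integral_const_mul, integral_legendrePoly_mul_of_ne hn, mul_zero]
    have h3 := h1.unique (hasSum_single m h2)
    rw [h3]
    simp only [mul_assoc]
    rw [intervalIntegral.integral_const_mul, integral_legendrePoly_sq]
  have hzero := eq_zero_of_integral_mul_legendrePoly_eq_zero (k := fun t => h t - S t)
    (hc.sub hSc) (fun n => by
      have hi : ∀ g : ℝ → ℝ, ContinuousOn g (Icc (-1) 1) →
          IntervalIntegrable (fun t => g t * (legendrePoly n).eval t) volume (-1) 1 := fun g hg =>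
        ContinuousOn.intervalIntegrable_of_Icc (by norm_num) (hg.mul (Polynomial.continuousOn _))
      simp only [sub_mul]
      rw [intervalIntegral.integral_sub (hi _ hc) (hi _ hSc), hcoef]
      simp only [a, legendreCoeff]
      field_simp
      ring)
  have : h t = S t := sub_eq_zero.1 (hzero t ht)
  rw [this]
  exact (hsum t ht).hasSum

/-- The Legendre expansion of `h` truncated after degree `n`. -/
noncomputable def legendreTrunc (h : ℝ → ℝ) (n : ℕ) : ℝ[X] :=
  ∑ k ∈ Finset.range (n + 1), C (legendreCoeff h k) * legendrePoly k

lemma natDegree_legendreTrunc_le (h : ℝ → ℝ) (n : ℕ) : (legendreTrunc h n).natDegree ≤ n := by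
  refine natDegree_sum_le_of_forall_le _ _ fun k hk => ?_
  refine (natDegree_C_mul_le _ _).trans ?_
  rw [natDegree_legendrePoly]
  exact Nat.lt_succ_iff.1 (Finset.mem_range.1 hk)

lemma integral_legendreTrunc_mul (h : ℝ → ℝ) {n m : ℕ} (hm : m ≤ n) :
    ∫ t in (-1 : ℝ)..1, (legendreTrunc h n).eval t * (legendrePoly m).eval t =
      ∫ t in (-1 : ℝ)..1, h t * (legendrePoly m).eval t := by
  simp only [legendreTrunc, eval_finsetSum, eval_mul, eval_C, Finset.sum_mul]
  rw [intervalIntegral.integral_finsetSum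
    (fun k _ => Continuous.intervalIntegrable (by fun_prop) _ _)]
  rw [Finset.sum_eq_single m]
  · simp only [mul_assoc]
    rw [intervalIntegral.integral_const_mul, integral_legendrePoly_sq, legendreCoeff]
    field_simp
  · intro k _ hk
    simp only [mul_assoc]
    rw [intervalIntegral.integral_const_mul, integral_legendrePoly_mul_of_ne hk, mul_zero]
  · intro hm'
    exact absurd (Finset.mem_range.2 (by omega)) hm'

lemma legendreCoeff_legendreTrunc (h : ℝ → ℝ) {n m : ℕ} (hm : m ≤ n) :
    legendreCoeff (fun t => (legendreTrunc h n).eval t) m = legendreCoeff h m := by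
  rw [legendreCoeff, integral_legendreTrunc_mul h hm, legendreCoeff]

/-- The remainder of the truncated expansion is orthogonal to the polynomials of low degree. -/
lemma integral_sub_legendreTrunc_mul {h : ℝ → ℝ} (hc : ContinuousOn h (Icc (-1) 1)) (n : ℕ)
    (p : ℝ[X]) (hp : p.degree < (n + 1 : ℕ)) :
    ∫ t in (-1 : ℝ)..1, (h t - (legendreTrunc h n).eval t) * p.eval t = 0 := by
  refine integral_mul_poly_eq_zero (hc.sub (Polynomial.continuousOn _)) (n + 1)
    (fun m hm => ?_) p hp
  have e : ∀ t, (h t - (legendreTrunc h n).eval t) * (legendrePoly m).eval t =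
      h t * (legendrePoly m).eval t -
        (legendreTrunc h n).eval t * (legendrePoly m).eval t := fun t => sub_mul _ _ _
  have hi : IntervalIntegrable (fun t => h t * (legendrePoly m).eval t) volume (-1) 1 :=
    ContinuousOn.intervalIntegrable_of_Icc (by norm_num) (hc.mul (Polynomial.continuousOn _))
  simp only [Pi.sub_apply, e]
  rw [intervalIntegral.integral_sub hi
    (Continuous.intervalIntegrable (by fun_prop) _ _),
    integral_legendreTrunc_mul h (Nat.lt_succ_iff.1 hm), sub_self]

/-- `∑_{k ≥ n} (k + 1)^{-3/2} ≤ 4 (n + 1)^{-1/2}`, in terms of partial sums. -/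
lemma sum_one_div_three_halves_le (n K : ℕ) :
    ∑ k ∈ Finset.range K, 1 / (((n + k : ℕ) + 1 : ℝ) * √((n + k : ℕ) + 1 : ℝ)) ≤
      4 / √((n : ℝ) + 1) := by
  have hstep : ∀ k : ℕ, 1 / (((n + k : ℕ) + 1 : ℝ) * √((n + k : ℕ) + 1 : ℝ)) ≤
      4 / √((n + k : ℕ) + 1 : ℝ) - 4 / √((n + (k + 1) : ℕ) + 1 : ℝ) := by
    intro k
    set x : ℝ := (n + k : ℕ) + 1 with hx
    have hx1 : 1 ≤ x := by rw [hx]; have : (0 : ℝ) ≤ (n + k : ℕ) := by positivity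
                           linarith
    have e : (((n + (k + 1) : ℕ) : ℝ) + 1) = x + 1 := by rw [hx]; push_cast; ring
    rw [e]
    have hp : 0 < √x := Real.sqrt_pos.2 (by linarith)
    have hp1 : 0 < √(x + 1) := Real.sqrt_pos.2 (by linarith)
    have s1 : √x ^ 2 = x := Real.sq_sqrt (by linarith)
    have s2 : √(x + 1) ^ 2 = x + 1 := Real.sq_sqrt (by linarith)
    have hle : √x ≤ √(x + 1) := Real.sqrt_le_sqrt (by linarith)
    rw [div_sub_div _ _ hp.ne' hp1.ne', div_le_div_iff₀ (by positivity) (by positivity)]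
    -- with `a = √x`, `b = √(x + 1)`: as `(b - a) (a + b) = 1`, it suffices that `b (a + b) ≤ 4 x`
    have h1 : (√(x + 1) - √x) * (√x + √(x + 1)) = 1 := by nlinarith
    have h2 : √(x + 1) * (√x + √(x + 1)) ≤ 4 * x := by nlinarith [sq_nonneg (√(x + 1) - √x)]
    have h3 : √(x + 1) ≤ 4 * x * (√(x + 1) - √x) := by
      refine le_of_mul_le_mul_right ?_ (add_pos hp hp1)
      rw [mul_assoc, h1, mul_one]
      exact h2
    calc 1 * (√x * √(x + 1)) ≤ 1 * (√x * (4 * x * (√(x + 1) - √x))) := by gcongr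
      _ = _ := by ring
  calc _ ≤ ∑ k ∈ Finset.range K, (4 / √((n + k : ℕ) + 1 : ℝ) - 4 / √((n + (k + 1) : ℕ) + 1 : ℝ)) :=
        Finset.sum_le_sum fun k _ => hstep k
    _ = 4 / √((n : ℝ) + 1) - 4 / √((n + K : ℕ) + 1 : ℝ) := by
        rw [Finset.sum_range_sub' (fun k => 4 / √((n + k : ℕ) + 1 : ℝ))]
        simp
    _ ≤ _ := by
        have : 0 ≤ 4 / √((n + K : ℕ) + 1 : ℝ) := by positivity
        linarith

/-- The Legendre coefficients of a function whose `(q+1)`-st derivative has bounded variation are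
`O(n^{-q-3/2})`. -/
lemma exists_abs_legendreCoeff_le (q : ℕ) (H : ℕ → ℝ → ℝ)
    (hc : ∀ k < q + 1, ContinuousOn (H k) (Icc (-1) 1))
    (hd : ∀ k < q + 1, ∀ t ∈ Ioo (-1 : ℝ) 1, HasDerivAt (H k) (H (k + 1) t) t)
    (hV : BoundedVariationOn (H (q + 1)) (Icc (-1) 1)) :
    ∃ C : ℝ, 0 ≤ C ∧ ∀ n : ℕ,
      |legendreCoeff (H 0) n| ≤ C / (((n : ℝ) + 1) ^ (q + 1) * √((n : ℝ) + 1)) := by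
  obtain ⟨C, hC⟩ := exists_integral_mul_legendrePoly_le (q + 1) H hc hd hV
  refine ⟨C, ?_, fun n => ?_⟩
  · have := (abs_nonneg _).trans (hC 0)
    simpa using this
  have hsq : 0 < √((n : ℝ) + 1) := Real.sqrt_pos.2 (by positivity)
  rw [legendreCoeff, abs_mul, abs_of_pos (by positivity)]
  calc _ ≤ ((n : ℝ) + 1) * (C / (((n : ℝ) + 1) ^ (q + 1 + 1) * √((n : ℝ) + 1))) :=
        mul_le_mul (by linarith) (hC n) (abs_nonneg _) (by positivity)
    _ = _ := by field_simp; ring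

/-- Summing the coefficient bound from `n` on loses one power of `n`. -/
lemma sum_tail_le {a : ℕ → ℝ} {C : ℝ} (hC0 : 0 ≤ C) (q : ℕ)
    (ha : ∀ n : ℕ, |a n| ≤ C / (((n : ℝ) + 1) ^ (q + 1) * √((n : ℝ) + 1))) (n K : ℕ) :
    ∑ k ∈ Finset.range K, |a (n + k)| ≤ 4 * C / (((n : ℝ) + 1) ^ q * √((n : ℝ) + 1)) := by
  have ha' : ∀ k : ℕ, |a (n + k)| ≤ C / ((n : ℝ) + 1) ^ q *
      (1 / (((n + k : ℕ) + 1 : ℝ) * √((n + k : ℕ) + 1 : ℝ))) := by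
    intro k
    refine (ha (n + k)).trans ?_
    have hsq : 0 < √((n + k : ℕ) + 1 : ℝ) := Real.sqrt_pos.2 (by positivity)
    have hle : ((n : ℝ) + 1) ^ q ≤ ((n + k : ℕ) + 1 : ℝ) ^ q := by
      gcongr
      exact Nat.le_add_right n k
    rw [pow_succ, mul_assoc, ← div_div, div_eq_mul_one_div (C / _)]
    exact mul_le_mul_of_nonneg_right (div_le_div_of_nonneg_left hC0 (by positivity) hle)
      (by positivity)
  calc _ ≤ ∑ k ∈ Finset.range K, C / ((n : ℝ) + 1) ^ q *
        (1 / (((n + k : ℕ) + 1 : ℝ) * √((n + k : ℕ) + 1 : ℝ))) :=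
        Finset.sum_le_sum fun k _ => ha' k
    _ ≤ C / ((n : ℝ) + 1) ^ q * (4 / √((n : ℝ) + 1)) := by
        rw [← Finset.mul_sum]
        exact mul_le_mul_of_nonneg_left (sum_one_div_three_halves_le n K) (by positivity)
    _ = _ := by rw [div_mul_div_comm, mul_comm C]

/-- The truncation error of the Legendre expansion of a function whose `(q+1)`-st derivative has
bounded variation is `O(n^{-q-1/2})`, uniformly on `[-1, 1]`. -/
lemma exists_sub_legendreTrunc_le (q : ℕ) (H : ℕ → ℝ → ℝ)
    (hc : ∀ k < q + 1, ContinuousOn (H k) (Icc (-1) 1))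
    (hd : ∀ k < q + 1, ∀ t ∈ Ioo (-1 : ℝ) 1, HasDerivAt (H k) (H (k + 1) t) t)
    (hV : BoundedVariationOn (H (q + 1)) (Icc (-1) 1)) :
    ∃ C : ℝ, 0 ≤ C ∧ ∀ n : ℕ, ∀ t ∈ Icc (-1 : ℝ) 1,
      |H 0 t - (legendreTrunc (H 0) n).eval t| ≤
        C / (((n : ℝ) + 1) ^ q * √((n : ℝ) + 1)) := by
  obtain ⟨C, hC0, ha⟩ := exists_abs_legendreCoeff_le q H hc hd hV
  have hpart := sum_tail_le hC0 q ha
  have hs : Summable fun n => |legendreCoeff (H 0) n| :=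
    summable_of_sum_range_le (c := 4 * C / ((((0 : ℕ) : ℝ) + 1) ^ q * √(((0 : ℕ) : ℝ) + 1)))
      (fun _ => abs_nonneg _) fun K => by simpa only [zero_add] using hpart 0 K
  refine ⟨4 * C, by positivity, fun n t ht => ?_⟩
  have hsum := hasSum_legendreCoeff (hc 0 (Nat.succ_pos q)) hs ht
  have htail := (hasSum_nat_add_iff' (n + 1)).2 hsum
  have e : H 0 t - (legendreTrunc (H 0) n).eval t =
      H 0 t - ∑ i ∈ Finset.range (n + 1), legendreCoeff (H 0) i * (legendrePoly i).eval t := by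
    simp [legendreTrunc, eval_finsetSum]
  have hs' : Summable fun k => |legendreCoeff (H 0) (k + (n + 1))| :=
    (summable_nat_add_iff (f := fun k => |legendreCoeff (H 0) k|) (n + 1)).2 hs
  rw [e]
  refine (htail.norm_le_of_bounded hs'.hasSum fun k => ?_).trans ?_
  · rw [Real.norm_eq_abs, abs_mul]
    exact mul_le_of_le_one_right (abs_nonneg _) (abs_legendrePoly_le_one _ ht)
  · refine Real.tsum_le_of_sum_range_le (fun _ => abs_nonneg _) fun K => ?_
    have h1 := hpart n (K + 1)
    rw [Finset.sum_range_succ'] at h1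
    refine (le_trans (le_of_eq ?_) (le_add_of_nonneg_right (abs_nonneg _))).trans h1
    exact Finset.sum_congr rfl fun k _ => by rw [show k + (n + 1) = n + (k + 1) by ring]

/-! ### Legendre-Gauss-Lobatto nodes and the differentiation matrix -/

/-- Two consecutive Legendre polynomials have no common root. -/
lemma legendrePoly_eval_ne_zero_of_succ (n : ℕ) {a : ℝ} (h : (legendrePoly (n + 1)).eval a = 0) :
    (legendrePoly n).eval a ≠ 0 := by
  induction n with
  | zero => simp [legendrePoly_zero]
  | succ n ih =>
    intro h0
    have e := congrArg (eval a) (legendrePoly_three_term n)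
    simp [h, h0] at e
    rcases e with e | e
    · have : (n : ℝ) + 1 ≠ 0 := by positivity
      exact this e
    · exact ih h0 e

lemma legendrePoly_le_succ {x : ℝ} (hx : 1 ≤ x) (n : ℕ) :
    1 ≤ (legendrePoly n).eval x ∧ (legendrePoly n).eval x ≤ (legendrePoly (n + 1)).eval x := by
  induction n with
  | zero => simpa [legendrePoly_zero, legendrePoly_one] using hx
  | succ n ih =>
    refine ⟨ih.1.trans ih.2, ?_⟩
    have e := congrArg (eval x) (legendrePoly_three_term n)
    simp at e
    have hn : (0 : ℝ) < (n : ℝ) + 2 := by positivity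
    have hn0 : (0 : ℝ) ≤ n := by positivity
    refine le_of_mul_le_mul_left ?_ hn
    rw [e]
    have h1 : (2 * (n : ℝ) + 3) * 1 * (legendrePoly (n + 1)).eval x ≤
        (2 * (n : ℝ) + 3) * x * (legendrePoly (n + 1)).eval x := by
      have := ih.1.trans ih.2
      gcongr
    have h2 := mul_le_mul_of_nonneg_left ih.2 (by positivity : (0 : ℝ) ≤ (n : ℝ) + 1)
    linarith

lemma derivative_legendrePoly_eval_pos {x : ℝ} (hx : 1 ≤ x) (n : ℕ) :
    0 < (derivative (legendrePoly (n + 1))).eval x := by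
  induction n using Nat.twoStepInduction with
  | zero => simp [legendrePoly_one]
  | one =>
    rw [derivative_legendrePoly_sub]
    simp [legendrePoly_zero, legendrePoly_one]
    linarith
  | more n h1 _ =>
    rw [derivative_legendrePoly_sub]
    have := (legendrePoly_le_succ hx (n + 2)).1
    simp only [eval_add, eval_mul, eval_natCast, eval_ofNat]
    positivity

/-- The derivative does not vanish outside `(-1, 1)`: it is positive on `[1, ∞)`, and even or
odd. -/
lemma abs_lt_one_of_derivative_legendrePoly_eq_zero {n : ℕ} {a : ℝ}
    (h : (derivative (legendrePoly (n + 1))).eval a = 0) : -1 < a ∧ a < 1 := by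
  constructor
  · by_contra hc
    have h1 := derivative_legendrePoly_eval_pos (x := -a) (by linarith) n
    rw [derivative_legendrePoly_eval_neg, h, mul_zero] at h1
    exact lt_irrefl _ h1
  · by_contra hc
    have h1 := derivative_legendrePoly_eval_pos (x := a) (by linarith) n
    rw [h] at h1
    exact lt_irrefl _ h1

lemma legendrePoly_eval_ne_zero_of_derivative {n : ℕ} {a : ℝ}
    (h : (derivative (legendrePoly (n + 1))).eval a = 0) :
    (legendrePoly (n + 1)).eval a ≠ 0 := by
  intro h0
  have e := congrArg (eval a) (one_sub_sq_mul_derivative_legendrePoly n)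
  simp [h, h0] at e
  rcases e with e | e
  · have : (n : ℝ) + 1 ≠ 0 := by positivity
    exact this e
  · exact legendrePoly_eval_ne_zero_of_succ n h0 e

lemma natDegree_derivative_legendrePoly (n : ℕ) :
    (derivative (legendrePoly (n + 1))).natDegree = n := by
  rw [natDegree_derivative, natDegree_legendrePoly, Nat.add_sub_cancel]

/-- `P'_{n+1}` has `n` distinct real roots: by Rolle's theorem all roots of the derivatives of
`(X² - 1)^(n+1)` are real, and those of `P'_{n+1}` are simple by the differential equation. -/
lemma card_roots_derivative_legendrePoly (n : ℕ) :
    (derivative (legendrePoly (n + 1))).roots.toFinset.card = n := by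
  have hroots : ∀ N k : ℕ, 2 * N ≤
      Multiset.card (derivative^[k] ((X ^ 2 - 1 : ℝ[X]) ^ N)).roots + k := by
    intro N k
    induction k with
    | zero =>
      have h0 : (X ^ 2 - 1 : ℝ[X]) = (X - C 1) * (X - C (-1)) := by
        simp only [C_neg, C_1]
        ring
      have h1 : ((X - C 1) * (X - C (-1)) : ℝ[X]) ≠ 0 :=
        mul_ne_zero (X_sub_C_ne_zero _) (X_sub_C_ne_zero _)
      simp only [Function.iterate_zero, id_eq, add_zero]
      rw [h0, roots_pow, roots_mul h1, roots_X_sub_C, roots_X_sub_C]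
      simp
      omega
    | succ k ih =>
      rw [Function.iterate_succ_apply']
      have := card_roots_le_derivative (derivative^[k] ((X ^ 2 - 1 : ℝ[X]) ^ N))
      omega
  set p := derivative (legendrePoly (n + 1)) with hp
  have hcard : Multiset.card p.roots = n := by
    apply le_antisymm
    · exact (card_roots' p).trans (natDegree_derivative_legendrePoly n).le
    · have h1 := hroots (n + 1) (n + 2)
      rw [hp, legendrePoly, derivative_C_mul, ← Function.iterate_succ_apply' (f := derivative),
        roots_C_mul _ (by positivity)]
      have h2 : Nat.succ (n + 1) = n + 2 := rfl
      rw [h2]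
      omega
  have hp0 : p ≠ 0 := by
    intro h
    have := derivative_legendrePoly_eval_pos le_rfl n
    rw [← hp, h] at this
    simp at this
  have hnodup : p.roots.Nodup := by
    rw [Multiset.nodup_iff_count_le_one]
    intro a
    rw [count_roots]
    by_contra hlt
    rw [not_le, one_lt_rootMultiplicity_iff_isRoot hp0] at hlt
    obtain ⟨h1, h2⟩ := hlt
    have h1' : p.eval a = 0 := h1
    have h2' : (derivative p).eval a = 0 := h2
    have e := congrArg (eval a) (legendrePoly_ode (n + 1))
    rw [derivative_mul] at e
    simp only [← hp, eval_add, eval_mul, h1', h2', mul_zero, add_zero] at e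
    have hne := legendrePoly_eval_ne_zero_of_derivative h1'
    simp at e
    rcases e with e | e
    · have : (n : ℝ) + 1 ≠ 0 := by positivity
      have : (n : ℝ) + 1 + 1 ≠ 0 := by positivity
      tauto
    · exact hne e
  rw [Multiset.toFinset_card_of_nodup hnodup, hcard]

lemma mem_lglSet {N : ℕ} {a : ℝ} : a ∈ lglSet (N + 1) ↔
    a = -1 ∨ a = 1 ∨ (derivative (legendrePoly (N + 1))).eval a = 0 := by
  have hp0 : derivative (legendrePoly (N + 1)) ≠ 0 := by
    intro h
    have := derivative_legendrePoly_eval_pos le_rfl N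
    rw [h] at this
    simp at this
  simp [lglSet, mem_roots hp0]

lemma card_lglSet (N : ℕ) : (lglSet (N + 1)).card = N + 1 + 1 := by
  have hmem : ∀ a ∈ (derivative (legendrePoly (N + 1))).roots.toFinset, -1 < a ∧ a < 1 := by
    intro a ha
    rw [Multiset.mem_toFinset] at ha
    exact abs_lt_one_of_derivative_legendrePoly_eq_zero (isRoot_of_mem_roots ha)
  rw [lglSet, Finset.card_insert_of_notMem, Finset.card_insert_of_notMem,
    card_roots_derivative_legendrePoly]
  · exact fun h => lt_irrefl _ (hmem _ h).2
  · rw [Finset.mem_insert]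
    rintro (h | h)
    · norm_num at h
    · exact lt_irrefl _ (hmem _ h).1

lemma lglNode_eq (N : ℕ) (k : Fin (N + 1 + 1)) :
    lglNode (N + 1) k = (lglSet (N + 1)).orderEmbOfFin (card_lglSet N) k := by
  rw [lglNode, Finset.orderEmbOfFin_apply, List.getD_eq_getElem]
  · simp
  · rw [Finset.length_sort, card_lglSet]
    exact k.2

lemma lglNode_injective (N : ℕ) : Function.Injective (lglNode (N + 1)) := by
  intro i j h
  rw [lglNode_eq, lglNode_eq] at h
  exact ((lglSet (N + 1)).orderEmbOfFin (card_lglSet N)).injective h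

lemma lglNode_mem (N : ℕ) (k : Fin (N + 1 + 1)) : lglNode (N + 1) k ∈ lglSet (N + 1) := by
  rw [lglNode_eq]
  exact Finset.orderEmbOfFin_mem _ _ _

lemma lglNode_mem_Icc (N : ℕ) (k : Fin (N + 1 + 1)) : lglNode (N + 1) k ∈ Icc (-1 : ℝ) 1 := by
  rcases mem_lglSet.1 (lglNode_mem N k) with h | h | h
  · rw [h]; simp
  · rw [h]; simp
  · have := abs_lt_one_of_derivative_legendrePoly_eq_zero h
    exact ⟨this.1.le, this.2.le⟩

lemma exists_lglNode_eq {N : ℕ} {a : ℝ} (ha : a ∈ lglSet (N + 1)) :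
    ∃ k, lglNode (N + 1) k = a := by
  have : a ∈ Set.range ((lglSet (N + 1)).orderEmbOfFin (card_lglSet N)) := by
    rw [Finset.range_orderEmbOfFin]
    exact ha
  obtain ⟨k, hk⟩ := this
  exact ⟨k, by rw [lglNode_eq, hk]⟩

lemma lglNode_mono (N : ℕ) {i j : Fin (N + 1 + 1)} (h : i ≤ j) :
    lglNode (N + 1) i ≤ lglNode (N + 1) j := by
  rw [lglNode_eq, lglNode_eq]
  exact ((lglSet (N + 1)).orderEmbOfFin (card_lglSet N)).monotone h

lemma lglNode_zero (N : ℕ) : lglNode (N + 1) 0 = -1 := by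
  obtain ⟨k, hk⟩ := exists_lglNode_eq (N := N) (a := -1) (mem_lglSet.2 (Or.inl rfl))
  apply le_antisymm
  · rw [← hk]
    exact lglNode_mono N (Fin.zero_le k)
  · exact (lglNode_mem_Icc N 0).1

lemma lglNode_last (N : ℕ) : lglNode (N + 1) (Fin.last (N + 1)) = 1 := by
  obtain ⟨k, hk⟩ := exists_lglNode_eq (N := N) (a := 1) (mem_lglSet.2 (Or.inr (Or.inl rfl)))
  apply le_antisymm
  · exact (lglNode_mem_Icc N _).2
  · conv_lhs => rw [← hk]
    exact lglNode_mono N (Fin.le_last k)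

/-- The polynomial `(1 - X²) P'_N`, whose roots are the LGL nodes. -/
noncomputable def lglPoly (N : ℕ) : ℝ[X] := (1 - X ^ 2) * derivative (legendrePoly N)

lemma lglPoly_eval_node (N : ℕ) (k : Fin (N + 1 + 1)) :
    (lglPoly (N + 1)).eval (lglNode (N + 1) k) = 0 := by
  rcases mem_lglSet.1 (lglNode_mem N k) with h | h | h <;> simp [lglPoly, h]

lemma derivative_lglPoly (N : ℕ) :
    derivative (lglPoly N) = C (-((N : ℝ) * (N + 1))) * legendrePoly N := by
  rw [lglPoly, legendrePoly_ode]
  simp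

lemma legendrePoly_eval_node_ne_zero (N : ℕ) (k : Fin (N + 1 + 1)) :
    (legendrePoly (N + 1)).eval (lglNode (N + 1) k) ≠ 0 := by
  rcases mem_lglSet.1 (lglNode_mem N k) with h | h | h
  · simp [h, legendrePoly_eval_neg, legendrePoly_eval_one]
  · simp [h, legendrePoly_eval_one]
  · exact legendrePoly_eval_ne_zero_of_derivative h

/-- The Lagrange basis polynomial `ℓ_k` satisfies `ω'(t_k) (X - t_k) ℓ_k = ω` for
`ω = (1 - X²) P'_N`. -/
lemma lglPoly_eq_mul_basis (N : ℕ) (k : Fin (N + 1 + 1)) :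
    lglPoly (N + 1) = (X - C (lglNode (N + 1) k)) *
      (C ((derivative (lglPoly (N + 1))).eval (lglNode (N + 1) k)) *
        Lagrange.basis Finset.univ (lglNode (N + 1)) k) := by
  have hinj := (lglNode_injective N).injOn (s := (Finset.univ : Finset (Fin (N + 1 + 1))))
  obtain ⟨g, hg⟩ := dvd_iff_isRoot.2 (lglPoly_eval_node N k)
  have hdeg : g.degree < (Finset.univ : Finset (Fin (N + 1 + 1))).card := by
    rw [Finset.card_univ, Fintype.card_fin]
    by_cases hg0 : g = 0
    · rw [hg0, degree_zero]
      exact WithBot.bot_lt_coe _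
    have h1 : (lglPoly (N + 1)).natDegree ≤ N + 2 := by
      refine natDegree_mul_le.trans ?_
      rw [natDegree_derivative_legendrePoly]
      have : (1 - X ^ 2 : ℝ[X]).natDegree ≤ 2 := by compute_degree
      omega
    rw [hg, natDegree_mul (X_sub_C_ne_zero _) hg0, natDegree_X_sub_C] at h1
    rw [degree_eq_natDegree hg0]
    exact_mod_cast (by omega : g.natDegree < N + 1 + 1)
  conv_lhs => rw [hg]
  congr 1
  have hgk : g.eval (lglNode (N + 1) k) =
      (derivative (lglPoly (N + 1))).eval (lglNode (N + 1) k) := by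
    rw [hg, derivative_mul]
    simp
  refine eq_of_degrees_lt_of_eval_index_eq _ hinj hdeg ?_ fun i hi => ?_
  · rw [← smul_eq_C_mul]
    refine (degree_smul_le _ _).trans_lt ?_
    rw [Lagrange.degree_basis hinj (Finset.mem_univ k)]
    simp
    exact_mod_cast Nat.lt_succ_self _
  · by_cases hik : i = k
    · subst hik
      rw [hgk, eval_mul, eval_C, Lagrange.eval_basis_self hinj (Finset.mem_univ _), mul_one]
    · rw [eval_mul, eval_C, Lagrange.eval_basis_of_ne (Ne.symm hik) (Finset.mem_univ _), mul_zero]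
      have h1 := lglPoly_eval_node N i
      rw [hg, eval_mul] at h1
      rcases mul_eq_zero.1 h1 with h1 | h1
      · rw [eval_sub, eval_X, eval_C, sub_eq_zero] at h1
        exact absurd (lglNode_injective N h1) hik
      · exact h1

lemma derivative_legendrePoly_eval_one (n : ℕ) :
    (derivative (legendrePoly n)).eval 1 = (n : ℝ) * (n + 1) / 2 := by
  have e := congrArg (eval 1) (legendrePoly_ode n)
  rw [derivative_mul] at e
  simp [legendrePoly_eval_one] at e
  linarith

/-- The entries of the differentiation matrix are the derivatives of the Lagrange basis
polynomials at the nodes. -/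
lemma diffMatrix_apply (N : ℕ) (i k : Fin (N + 1 + 1)) :
    diffMatrix (N + 1) i k =
      (derivative (Lagrange.basis Finset.univ (lglNode (N + 1)) k)).eval (lglNode (N + 1) i) := by
  have hinj := (lglNode_injective N).injOn (s := (Finset.univ : Finset (Fin (N + 1 + 1))))
  have hk := legendrePoly_eval_node_ne_zero N k
  have hlam : ((N : ℝ) + 1) * ((N : ℝ) + 1 + 1) ≠ 0 := by positivity
  set ℓ := Lagrange.basis Finset.univ (lglNode (N + 1)) k with hl
  have hω := lglPoly_eq_mul_basis N k
  have hω' := derivative_lglPoly (N + 1)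
  rw [← hl] at hω
  set c := (derivative (lglPoly (N + 1))).eval (lglNode (N + 1) k) with hc
  have hcv : c = -(((N : ℝ) + 1) * ((N : ℝ) + 1 + 1)) *
      (legendrePoly (N + 1)).eval (lglNode (N + 1) k) := by
    rw [hc, hω']
    simp
  have hc0 : c ≠ 0 := by
    rw [hcv]
    exact mul_ne_zero (neg_ne_zero.2 hlam) hk
  have hd := congrArg derivative hω
  rw [hω'] at hd
  by_cases hik : i = k
  · have hdd := congrArg (eval (lglNode (N + 1) k)) (congrArg derivative hd)
    simp only [derivative_mul, derivative_sub, derivative_X, derivative_C,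
      derivative_add, eval_add, eval_mul, eval_sub, eval_X, eval_C, sub_self,
      sub_zero, zero_mul, add_zero, one_mul, zero_add] at hdd
    rw [hik]
    have h2 : (derivative ℓ).eval (lglNode (N + 1) k) =
        (derivative (legendrePoly (N + 1))).eval (lglNode (N + 1) k) /
          (2 * (legendrePoly (N + 1)).eval (lglNode (N + 1) k)) := by
      rw [eq_div_iff (mul_ne_zero two_ne_zero hk)]
      apply mul_left_cancel₀ hlam
      rw [hcv] at hdd
      push_cast at hdd
      linear_combination hdd
    rw [h2]
    simp only [diffMatrix, Matrix.of_apply, ne_eq, not_true_eq_false, if_false]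
    have e1 := derivative_legendrePoly_eval_one (N + 1)
    split_ifs with h0 h1
    · rw [h0, lglNode_zero, derivative_legendrePoly_eval_neg, legendrePoly_eval_neg, e1,
        legendrePoly_eval_one]
      have : ((-1 : ℝ)) ^ (N + 1) ≠ 0 := pow_ne_zero _ (by norm_num)
      rw [pow_succ (-1 : ℝ) (N + 1)]
      field_simp
      ring
    · rw [h1, lglNode_last, e1, legendrePoly_eval_one]
      ring
    · rcases mem_lglSet.1 (lglNode_mem N k) with h | h | h
      · exact absurd (lglNode_injective N (h.trans (lglNode_zero N).symm)) h0
      · exact absurd (lglNode_injective N (h.trans (lglNode_last N).symm)) h1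
      · rw [h, zero_div]
  · have hne : lglNode (N + 1) i - lglNode (N + 1) k ≠ 0 :=
      sub_ne_zero.2 fun h => hik (lglNode_injective N h)
    have hd' := congrArg (eval (lglNode (N + 1) i)) hd
    have hli : ℓ.eval (lglNode (N + 1) i) = 0 :=
      Lagrange.eval_basis_of_ne (Ne.symm hik) (Finset.mem_univ _)
    simp only [derivative_mul, derivative_sub, derivative_X, derivative_C, eval_add, eval_mul,
      eval_sub, eval_X, eval_C, sub_zero, zero_mul, zero_add, one_mul, hli, mul_zero] at hd'
    simp only [diffMatrix, Matrix.of_apply, ne_eq, hik, not_false_eq_true, if_true]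
    rw [hcv] at hd'
    push_cast at hd'
    rw [div_mul_div_comm, mul_one, div_eq_iff (mul_ne_zero hk hne)]
    apply mul_left_cancel₀ hlam
    linear_combination -hd'

/-- The differentiation matrix differentiates the interpolation polynomial at the nodes. -/
lemma diffMatrix_mulVec (N : ℕ) (v : Fin (N + 1 + 1) → ℝ) :
    diffMatrix (N + 1) *ᵥ v =
      fun i => (derivative (interp (N + 1) v)).eval (lglNode (N + 1) i) := by
  funext i
  rw [interp, Lagrange.interpolate_apply, derivative_sum, eval_finsetSum, Matrix.mulVec,
    dotProduct]
  refine Finset.sum_congr rfl fun k _ => ?_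
  rw [diffMatrix_apply, derivative_C_mul, eval_mul, eval_C, mul_comm]

lemma interp_eval_node (N : ℕ) (v : Fin (N + 1 + 1) → ℝ) (k : Fin (N + 1 + 1)) :
    (interp (N + 1) v).eval (lglNode (N + 1) k) = v k :=
  Lagrange.eval_interpolate_at_node v (lglNode_injective N).injOn (Finset.mem_univ k)

lemma interp_eval_poly (N : ℕ) {p : ℝ[X]} (hp : p.natDegree ≤ N + 1) :
    interp (N + 1) (fun k => p.eval (lglNode (N + 1) k)) = p := by
  refine (Lagrange.eq_interpolate (lglNode_injective N).injOn ?_).symm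
  refine degree_le_natDegree.trans_lt ?_
  rw [Finset.card_univ, Fintype.card_fin]
  exact_mod_cast Nat.lt_succ_of_le hp

lemma natDegree_interp_le (N : ℕ) (v : Fin (N + 1 + 1) → ℝ) :
    (interp (N + 1) v).natDegree ≤ N + 1 := by
  have := Lagrange.degree_interpolate_lt v
    ((lglNode_injective N).injOn (s := (Finset.univ : Finset (Fin (N + 1 + 1)))))
  rw [Finset.card_univ, Fintype.card_fin] at this
  refine natDegree_le_of_degree_le (Order.lt_succ_iff.1 (this.trans_le ?_))
  exact le_of_eq rfl

/-- On values of a polynomial of degree at most `N`, powers of the differentiation matrix act as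
iterated derivatives. -/
lemma diffMatrix_pow_mulVec (N : ℕ) {p : ℝ[X]} (hp : p.natDegree ≤ N + 1) (j : ℕ) :
    (diffMatrix (N + 1) ^ j) *ᵥ (fun k => p.eval (lglNode (N + 1) k)) =
      fun k => (derivative^[j] p).eval (lglNode (N + 1) k) := by
  induction j with
  | zero => simp
  | succ j ih =>
    rw [pow_succ', ← Matrix.mulVec_mulVec, ih, diffMatrix_mulVec, interp_eval_poly,
      Function.iterate_succ_apply']
    exact (natDegree_iterate_derivative p j).trans ((Nat.sub_le _ _).trans hp)

/-- If the differentiation matrix maps the values of one interpolation polynomial to those of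
another, then the second polynomial is the derivative of the first. -/
lemma derivative_interp_eq (N : ℕ) {v w : Fin (N + 1 + 1) → ℝ}
    (h : diffMatrix (N + 1) *ᵥ v = w) : derivative (interp (N + 1) v) = interp (N + 1) w := by
  rw [← h, diffMatrix_mulVec, interp_eval_poly]
  exact (natDegree_derivative_le _).trans ((Nat.sub_le _ _).trans (natDegree_interp_le N v))

/-! ### Integrating an approximation along the chain of derivatives -/

lemma exists_derivative_eq (p : ℝ[X]) (c : ℝ) :
    ∃ P : ℝ[X], derivative P = p ∧ P.natDegree ≤ p.natDegree + 1 ∧ P.eval (-1) = c := by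
  set Q : ℝ[X] := ∑ i ∈ Finset.range (p.natDegree + 1), C (p.coeff i / (i + 1)) * X ^ (i + 1)
  have hQ : derivative Q = p := by
    simp only [Q, derivative_sum]
    conv_rhs => rw [p.as_sum_range_C_mul_X_pow]
    refine Finset.sum_congr rfl fun i _ => ?_
    have : (i : ℝ) + 1 ≠ 0 := by positivity
    rw [derivative_C_mul_X_pow]
    push_cast
    rw [div_mul_cancel₀ _ this]
  have hdeg : Q.natDegree ≤ p.natDegree + 1 := by
    refine natDegree_sum_le_of_forall_le _ _ fun i hi => ?_
    have := Finset.mem_range.1 hi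
    exact (natDegree_C_mul_X_pow_le _ _).trans (by omega)
  refine ⟨Q + C (c - Q.eval (-1)), by simp [hQ], ?_, by simp⟩
  rw [natDegree_add_C]
  exact hdeg

/-- One integration: an approximation `p` of `y'` whose error is orthogonal to the polynomials of
degree at most `K` has a primitive that approximates `y`, takes the values of `y` at both
endpoints, and whose error is orthogonal to the polynomials of degree less than `K`. -/
lemma exists_primitive_approx {y z : ℝ → ℝ} (hy : ContinuousOn y (Icc (-1) 1))
    (hd : ∀ t ∈ Ioo (-1 : ℝ) 1, HasDerivAt y (z t) t) (hz : ContinuousOn z (Icc (-1) 1))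
    {p : ℝ[X]} {ε : ℝ} (hp : ∀ t ∈ Icc (-1 : ℝ) 1, |z t - p.eval t| ≤ ε) {K : ℕ}
    (ho : ∀ s : ℝ[X], s.degree < (K + 1 : ℕ) →
      ∫ t in (-1 : ℝ)..1, (z t - p.eval t) * s.eval t = 0) :
    ∃ P : ℝ[X], derivative P = p ∧ P.natDegree ≤ p.natDegree + 1 ∧
      P.eval (-1) = y (-1) ∧ P.eval 1 = y 1 ∧
      (∀ t ∈ Icc (-1 : ℝ) 1, |y t - P.eval t| ≤ 2 * ε) ∧
      ∀ s : ℝ[X], s.degree < K → ∫ t in (-1 : ℝ)..1, (y t - P.eval t) * s.eval t = 0 := by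
  obtain ⟨P, hP, hPd, hP1⟩ := exists_derivative_eq p (y (-1))
  have hε : 0 ≤ ε := (abs_nonneg _).trans (hp 0 (by simp))
  have hec : ContinuousOn (fun t => y t - P.eval t) (Icc (-1) 1) := hy.sub P.continuousOn
  have hed : ∀ t ∈ Ioo (-1 : ℝ) 1,
      HasDerivAt (fun t => y t - P.eval t) (z t - p.eval t) t := fun t ht => by
    have := P.hasDerivAt t
    rw [hP] at this
    exact (hd t ht).sub this
  have hzc : ContinuousOn (fun t => z t - p.eval t) (Icc (-1) 1) := hz.sub p.continuousOn
  have hint : ∀ t ∈ Icc (-1 : ℝ) 1,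
      ∫ s in (-1 : ℝ)..t, (z s - p.eval s) = y t - P.eval t := by
    intro t ht
    have hsub : Icc (-1) t ⊆ Icc (-1 : ℝ) 1 := Icc_subset_Icc_right ht.2
    rw [intervalIntegral.integral_eq_sub_of_hasDerivAt_of_le ht.1 (hec.mono hsub)
      (fun s hs => hed s ⟨hs.1, hs.2.trans_le ht.2⟩)
      (ContinuousOn.intervalIntegrable_of_Icc ht.1 (hzc.mono hsub)), hP1]
    ring
  have hend : y 1 - P.eval 1 = 0 := by
    rw [← hint 1 (by simp)]
    have := ho 1 (by rw [degree_one]; exact_mod_cast Nat.succ_pos K)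
    simpa using this
  refine ⟨P, hP, hPd, hP1, (sub_eq_zero.1 hend).symm, fun t ht => ?_, fun s hs => ?_⟩
  · rw [← hint t ht]
    refine (abs_integral_le_of_abs_le ht.1 fun s hs => hp s ⟨hs.1, hs.2.trans ht.2⟩).trans ?_
    have : t - -1 ≤ 2 := by linarith [ht.2]
    nlinarith
  · obtain ⟨S, hS, hSd, -⟩ := exists_derivative_eq s 0
    have hSdeg : S.degree < (K + 1 : ℕ) := by
      by_cases hs0 : s = 0
      · have hS0 : S.natDegree = 0 := derivative_eq_zero.1 (hS.trans hs0)
        exact (degree_le_of_natDegree_le hS0.le).trans_lt (by exact_mod_cast Nat.succ_pos K)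
      · rw [degree_eq_natDegree hs0] at hs
        have : s.natDegree < K := by exact_mod_cast hs
        exact degree_le_natDegree.trans_lt (by exact_mod_cast (by omega : S.natDegree < K + 1))
    have key := intervalIntegral.integral_mul_deriv_eq_deriv_mul_of_hasDerivAt (a := -1) (b := 1)
      (u := fun t => y t - P.eval t) (v := fun t => S.eval t) (u' := fun t => z t - p.eval t)
      (v' := fun t => s.eval t) (by simpa using hec) S.continuousOn (by simpa using hed)
      (fun t _ => by
        have := S.hasDerivAt t
        rwa [hS] at this)
      (ContinuousOn.intervalIntegrable_of_Icc (by norm_num) hzc) (intervalIntegrable_poly _ _ _)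
    rw [key, ho S hSdeg, hend, hP1]
    ring

/-- Iterated integration along `Y 0, …, Y L`, each the derivative of the preceding one. Each
integration uses up one degree of orthogonality of the error and at most doubles its size. -/
lemma exists_chain_approx (L : ℕ) : ∀ (Y : ℕ → ℝ → ℝ) (K : ℕ),
    (∀ j ≤ L, ContinuousOn (Y j) (Icc (-1) 1)) →
    (∀ j < L, ∀ t ∈ Ioo (-1 : ℝ) 1, HasDerivAt (Y j) (Y (j + 1) t) t) →
    ∀ (p : ℝ[X]) (ε : ℝ), (∀ t ∈ Icc (-1 : ℝ) 1, |Y L t - p.eval t| ≤ ε) →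
    (∀ s : ℝ[X], s.degree < (K + L : ℕ) →
      ∫ t in (-1 : ℝ)..1, (Y L t - p.eval t) * s.eval t = 0) →
    ∃ q : ℕ → ℝ[X], q L = p ∧
      (∀ j < L, derivative (q j) = q (j + 1) ∧ (q j).eval (-1) = Y j (-1) ∧
        (q j).eval 1 = Y j 1) ∧
      (∀ j ≤ L, (q j).natDegree ≤ p.natDegree + (L - j) ∧
        ∀ t ∈ Icc (-1 : ℝ) 1, |Y j t - (q j).eval t| ≤ 2 ^ L * ε) ∧
      ∀ s : ℝ[X], s.degree < K →
        ∫ t in (-1 : ℝ)..1, (Y 0 t - (q 0).eval t) * s.eval t = 0 := by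
  induction L with
  | zero =>
    intro Y K _ _ p ε hp ho
    refine ⟨fun _ => p, rfl, by simp, fun j hj => ?_, ho⟩
    obtain rfl : j = 0 := by omega
    simpa using hp
  | succ L ih =>
    intro Y K hc hd p ε hp ho
    have hε : 0 ≤ ε := (abs_nonneg _).trans (hp 0 (by simp))
    obtain ⟨q, hqL, hq1, hq2, hq3⟩ := ih (fun j => Y (j + 1)) (K + 1)
      (fun j hj => hc (j + 1) (by omega)) (fun j hj => hd (j + 1) (by omega)) p ε hp
      (by rwa [show K + 1 + L = K + (L + 1) by ring])
    obtain ⟨P, hP, hPd, hP1, hP2, hP3, hP4⟩ := exists_primitive_approx (hc 0 (by omega))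
      (hd 0 (by omega)) (hc 1 (by omega)) (hq2 0 (by omega)).2 hq3
    refine ⟨fun j => match j with | 0 => P | j + 1 => q j, hqL, ?_, ?_, hP4⟩
    · rintro (_ | j) hj
      · exact ⟨hP, hP1, hP2⟩
      · exact hq1 j (by omega)
    · rintro (_ | j) hj
      · refine ⟨?_, fun t ht => (hP3 t ht).trans (le_of_eq (by ring))⟩
        have := (hq2 0 (by omega)).1
        exact hPd.trans (by omega)
      · refine ⟨?_, fun t ht => ((hq2 j (by omega)).2 t ht).trans ?_⟩
        · have := (hq2 j (by omega)).1
          simp only [Nat.add_sub_add_right] at this ⊢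
          exact this
        · rw [pow_succ]
          have : 0 ≤ 2 ^ L * ε := by positivity
          linarith

/-! ### Second-order and uniform continuity estimates -/

/-- The second difference of a `C²` function is quadratically small, uniformly on balls. -/
lemma exists_second_difference_le {V : Type*} [NormedAddCommGroup V] [NormedSpace ℝ V]
    [ProperSpace V] {G : V → ℝ} (hG : ContDiff ℝ 2 G) (R : ℝ) :
    ∃ C : ℝ, 0 ≤ C ∧ ∀ z ζ : V, ‖z‖ ≤ R → ‖ζ‖ ≤ 1 →
      G (z + ζ) + G (z - ζ) - 2 * G z ≤ C * ‖ζ‖ ^ 2 := by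
  have hG' : ContDiff ℝ 1 (fderiv ℝ G) := hG.fderiv_right (by norm_num)
  have hGd : Differentiable ℝ G := hG.differentiable (by norm_num)
  obtain ⟨C, hC⟩ := (hG'.contDiffOn (s := Metric.closedBall (0 : V) (R + 1))).exists_lipschitzOnWith
    (by norm_num) (convex_closedBall _ _) (isCompact_closedBall _ _)
  have key : ∀ z ζ : V, ‖z‖ ≤ R → ‖ζ‖ ≤ 1 →
      |G (z + ζ) - G z - fderiv ℝ G z ζ| ≤ C * ‖ζ‖ ^ 2 := by
    intro z ζ hz hζ
    have hseg : ∀ w ∈ segment ℝ z (z + ζ), ‖fderiv ℝ G w - fderiv ℝ G z‖ ≤ C * ‖ζ‖ := by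
      intro w hw
      have hwz : ‖w - z‖ ≤ ‖ζ‖ := by
        rw [segment_eq_image'] at hw
        obtain ⟨θ, hθ, rfl⟩ := hw
        simp only [add_sub_cancel_left, norm_smul, Real.norm_eq_abs, abs_of_nonneg hθ.1]
        exact mul_le_of_le_one_left (norm_nonneg _) hθ.2
      have hwR : ‖w‖ ≤ R + 1 := by
        have := norm_add_le (w - z) z
        rw [sub_add_cancel] at this
        linarith
      have h := hC.dist_le_mul w (by simpa using hwR) z (by simpa using by linarith)
      rw [dist_eq_norm, dist_eq_norm] at h
      exact h.trans (mul_le_mul_of_nonneg_left hwz C.2)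
    have h := (convex_segment z (z + ζ)).norm_image_sub_le_of_norm_fderiv_le' (𝕜 := ℝ)
      (fun w _ => hGd w) hseg (left_mem_segment _ _ _) (right_mem_segment _ _ _)
    rw [add_sub_cancel_left] at h
    rw [← Real.norm_eq_abs]
    exact h.trans (le_of_eq (by ring))
  refine ⟨2 * C, by positivity, fun z ζ hz hζ => ?_⟩
  have h1 := (abs_le.1 (key z ζ hz hζ)).2
  have h2 := (abs_le.1 (key z (-ζ) hz (by rwa [norm_neg]))).2
  rw [norm_neg, map_neg, ← sub_eq_add_neg] at h2
  linarith

lemma exists_forall_abs_sub_le {V : Type*} [NormedAddCommGroup V] [ProperSpace V] {Φ : V → ℝ}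
    (hΦ : Continuous Φ) (R : ℝ) {ε : ℝ} (hε : 0 < ε) :
    ∃ δ > 0, ∀ z w : V, ‖z‖ ≤ R → ‖w - z‖ ≤ δ → |Φ w - Φ z| ≤ ε := by
  have hu := (isCompact_closedBall (0 : V) (R + 1)).uniformContinuousOn_of_continuous
    hΦ.continuousOn
  obtain ⟨δ, hδ, h⟩ := Metric.uniformContinuousOn_iff_le.1 hu ε hε
  refine ⟨min δ 1, lt_min hδ one_pos, fun z w hz hw => ?_⟩
  have h1 := hw.trans (min_le_left _ _)
  have h2 := hw.trans (min_le_right _ _)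
  have hwR : ‖w‖ ≤ R + 1 := by
    have := norm_add_le (w - z) z
    rw [sub_add_cancel] at this
    linarith
  have := h w (by simpa using hwR) z (by simpa using by linarith) (by rwa [dist_eq_norm])
  rwa [Real.dist_eq] at this

/-! ### Strong derivatives -/

lemma continuousOn_strongDeriv {m : ℕ} {ξ : ℝ → ℝ} (h : HasStrongDerivBV m ξ) {k : ℕ}
    (hk : k < m) : ContinuousOn (strongDeriv k ξ) (Icc (-1) 1) := (h.1 k hk).continuousOn

lemma hasDerivAt_strongDeriv {m : ℕ} {ξ : ℝ → ℝ} (h : HasStrongDerivBV m ξ) {k : ℕ}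
    (hk : k < m) {t : ℝ} (ht : t ∈ Ioo (-1 : ℝ) 1) :
    HasDerivAt (strongDeriv k ξ) (strongDeriv (k + 1) ξ t) t := by
  have hmem : Icc (-1 : ℝ) 1 ∈ nhds t := Icc_mem_nhds ht.1 ht.2
  have h1 := (h.1 k hk t (Ioo_subset_Icc_self ht)).differentiableAt hmem
  have h2 : strongDeriv (k + 1) ξ t = deriv (strongDeriv k ξ) t := by
    rw [strongDeriv, iteratedDerivWithin_succ, derivWithin_of_mem_nhds hmem]
    rfl
  rw [h2]
  exact h1.hasDerivAt

lemma exists_abs_strongDeriv_le {m : ℕ} {ξ : ℝ → ℝ} (h : HasStrongDerivBV m ξ) {k : ℕ}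
    (hk : k ≤ m) : ∃ B : ℝ, ∀ t ∈ Icc (-1 : ℝ) 1, |strongDeriv k ξ t| ≤ B := by
  rcases hk.lt_or_eq with hk | rfl
  · exact isCompact_Icc.exists_bound_of_continuousOn (continuousOn_strongDeriv h hk)
  · refine ⟨|strongDeriv k ξ (-1)| + (eVariationOn (strongDeriv k ξ) (Icc (-1) 1)).toReal,
      fun t ht => ?_⟩
    have h1 := h.2.dist_le ht (left_mem_Icc.2 (by norm_num : (-1 : ℝ) ≤ 1))
    rw [Real.dist_eq] at h1
    have h2 := abs_sub_abs_le_abs_sub (strongDeriv k ξ t) (strongDeriv k ξ (-1))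
    linarith

lemma boundedVariationOn_strongDeriv {m : ℕ} {ξ : ℝ → ℝ} (h : HasStrongDerivBV m ξ) {k : ℕ}
    (hk : k ≤ m) : BoundedVariationOn (strongDeriv k ξ) (Icc (-1) 1) := by
  rcases hk.lt_or_eq with hk | rfl
  · obtain ⟨B, hB⟩ := exists_abs_strongDeriv_le h (Nat.succ_le_of_lt hk)
    have hl : LipschitzOnWith B.toNNReal (strongDeriv k ξ) (Icc (-1) 1) := by
      refine (convex_Icc _ _).lipschitzOnWith_of_nnnorm_derivWithin_le (h.1 k hk) fun t ht => ?_
      rw [← NNReal.coe_le_coe, coe_nnnorm]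
      have := hB t ht
      rw [strongDeriv, iteratedDerivWithin_succ] at this
      exact this.trans (Real.le_coe_toNNReal B)
    simpa using hl.comp_boundedVariationOn (mapsTo_id _) (BoundedVariationOn.id_Icc (-1) 1)
  · exact h.2

/-- An absolutely continuous function with an a.e. derivative that is continuous is differentiable
everywhere in the interior. -/
lemma hasDerivAt_of_absolutelyContinuous {y z : ℝ → ℝ}
    (hy : AbsolutelyContinuousOnInterval y (-1) 1) (hz : ContinuousOn z (Icc (-1) 1))
    (h : ∀ᵐ t ∂(volume.restrict (Icc (-1 : ℝ) 1)), HasDerivAt y (z t) t) {t : ℝ}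
    (ht : t ∈ Ioo (-1 : ℝ) 1) : HasDerivAt y (z t) t := by
  rw [ae_restrict_iff' measurableSet_Icc] at h
  have hint : ∀ s ∈ Icc (-1 : ℝ) 1, y s = y (-1) + ∫ τ in (-1 : ℝ)..s, z τ := by
    intro s hs
    have h1 := (hy.mono (c := -1) (d := s) (by
      rw [uIcc_of_le hs.1, uIcc_of_le (by norm_num)]
      exact Icc_subset_Icc_right hs.2)).integral_deriv_eq_sub
    have h2 : ∫ τ in (-1 : ℝ)..s, deriv y τ = ∫ τ in (-1 : ℝ)..s, z τ := by
      refine intervalIntegral.integral_congr_ae ?_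
      filter_upwards [h] with τ hτ hmem
      rw [uIoc_of_le hs.1] at hmem
      exact (hτ ⟨hmem.1.le, hmem.2.trans hs.2⟩).deriv
    linarith
  have hnhds : Icc (-1 : ℝ) 1 ∈ nhds t := Icc_mem_nhds ht.1 ht.2
  have hd : HasDerivAt (fun s => y (-1) + ∫ τ in (-1 : ℝ)..s, z τ) (z t) t := by
    refine HasDerivAt.const_add _ (intervalIntegral.integral_hasDerivAt_right
      (ContinuousOn.intervalIntegrable_of_Icc ht.1.le
        (hz.mono (Icc_subset_Icc_right ht.2.le))) ?_ (hz.continuousAt hnhds))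
    exact (hz.mono Ioo_subset_Icc_self).stronglyMeasurableAtFilter isOpen_Ioo t ht
  exact hd.congr_of_eventuallyEq (Filter.eventually_of_mem hnhds hint)

lemma absolutelyContinuousOnInterval_poly (p : ℝ[X]) :
    AbsolutelyContinuousOnInterval (fun t => p.eval t) (-1) 1 := by
  have e : (fun t : ℝ => p.eval t) = fun t => aeval t p :=
    funext fun t => (congrFun (coe_aeval_eq_eval t) p).symm
  rw [e]
  exact (contDiff_aeval p 1).contDiffOn.absolutelyContinuousOnInterval

/-! ### Feasible pairs and their costs in terms of `x` and the derivative of `x_r` -/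

/-- The control that produces the derivative `z.2` of the last coordinate at the state `z.1`. -/
noncomputable def ControlProblem.feedback {r : ℕ} (P : ControlProblem r)
    (z : (Fin r → ℝ) × ℝ) : ℝ := (z.2 - P.f z.1) / P.g z.1

/-- The running cost as a function of the state and of the derivative of its last coordinate. -/
noncomputable def ControlProblem.integrand {r : ℕ} (P : ControlProblem r)
    (z : (Fin r → ℝ) × ℝ) : ℝ := P.F (z.1, P.feedback z)

lemma ControlProblem.contDiff_integrand {r : ℕ} (P : ControlProblem r) {m : ℕ}
    (hf : ContDiff ℝ m P.f) (hg : ContDiff ℝ m P.g) (hF : ContDiff ℝ m P.F) :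
    ContDiff ℝ m P.integrand := by
  refine hF.comp (contDiff_fst.prodMk ?_)
  exact (contDiff_snd.sub (hf.comp contDiff_fst)).div (hg.comp contDiff_fst)
    fun z => P.g_ne_zero _

lemma ControlProblem.continuous_feedback {r : ℕ} (P : ControlProblem r) :
    Continuous P.feedback := by
  obtain ⟨_, hf⟩ := P.f_lipschitz
  obtain ⟨_, hg⟩ := P.g_lipschitz
  exact (continuous_snd.sub (hf.continuous.comp continuous_fst)).div
    (hg.continuous.comp continuous_fst) fun z => P.g_ne_zero _

lemma ControlProblem.feedback_spec {r : ℕ} (P : ControlProblem r) (z : (Fin r → ℝ) × ℝ) :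
    P.f z.1 + P.g z.1 * P.feedback z = z.2 := by
  rw [feedback, mul_div_cancel₀ _ (P.g_ne_zero _)]
  ring

lemma ControlProblem.feedback_unique {r : ℕ} (P : ControlProblem r) {y : Fin r → ℝ} {v u : ℝ}
    (h : P.f y + P.g y * u = v) : u = P.feedback (y, v) := by
  rw [feedback, eq_div_iff (P.g_ne_zero _)]
  simp only
  linarith

lemma ControlProblem.isFeasible_feedback {r : ℕ} [NeZero r] (P : ControlProblem r)
    {y : ℝ → Fin r → ℝ} {v : ℝ → ℝ}
    (hac : ∀ i, AbsolutelyContinuousOnInterval (fun t => y t i) (-1) 1)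
    (hchain : ∀ i j : Fin r, (j : ℕ) = i + 1 →
      ∀ᵐ t ∂(volume.restrict (Icc (-1 : ℝ) 1)), HasDerivAt (fun s => y s i) (y t j) t)
    (hlast : ∀ᵐ t ∂(volume.restrict (Icc (-1 : ℝ) 1)),
      HasDerivAt (fun s => y s (lastIdx r)) (v t) t)
    (hv : ContinuousOn v (Icc (-1) 1)) (hinit : y (-1) = P.x₀) :
    P.IsFeasible y fun t => P.feedback (y t, v t) := by
  have hyc : ContinuousOn y (Icc (-1) 1) := continuousOn_pi.2 fun i => by
    have := (hac i).continuousOn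
    rwa [uIcc_of_le (by norm_num)] at this
  have huc : ContinuousOn (fun t => P.feedback (y t, v t)) (Icc (-1) 1) :=
    P.continuous_feedback.comp_continuousOn (hyc.prodMk hv)
  obtain ⟨B, hB⟩ := isCompact_Icc.exists_bound_of_continuousOn huc
  refine ⟨memLp_top_of_bound (huc.aestronglyMeasurable measurableSet_Icc) B
    ((ae_restrict_iff' measurableSet_Icc).2 (Filter.Eventually.of_forall hB)), hac, hchain, ?_,
    hinit⟩
  filter_upwards [hlast] with t ht
  rwa [P.feedback_spec (y t, v t)]

/-- Interpolations of feasible discrete states are feasible: as polynomials of degree at most `N`,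
they satisfy the differential equations exactly. -/
lemma ControlProblem.isFeasible_of_isDiscreteFeasible {r : ℕ} [NeZero r] (P : ControlProblem r)
    {b : SearchBounds r} {m₁ N : ℕ} {xb : Fin (N + 1 + 1) → Fin r → ℝ} {ub : Fin (N + 1 + 1) → ℝ}
    (h : P.IsDiscreteFeasible b m₁ (N + 1) xb ub) :
    P.IsFeasible (stateInterp xb) (P.controlInterp xb) := by
  refine P.isFeasible_feedback (y := stateInterp xb)
    (v := fun t => (derivative (interp (N + 1) fun k => xb k (lastIdx r))).eval t)
    (fun i => absolutelyContinuousOnInterval_poly _) (fun i j hij => ?_) ?_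
    (Polynomial.continuousOn _) ?_
  · refine Filter.Eventually.of_forall fun t => ?_
    have h1 := Polynomial.hasDerivAt (interp (N + 1) fun k => xb k i) t
    rw [derivative_interp_eq N (h.chain i j hij)] at h1
    exact h1
  · exact Filter.Eventually.of_forall fun t => Polynomial.hasDerivAt _ t
  · rw [← h.init]
    funext i
    have := interp_eval_node N (fun k => xb k i) 0
    rwa [lglNode_zero] at this

/-- The state whose coordinates are the first `r` polynomials of a sequence. -/
noncomputable def polyState (r : ℕ) (q : ℕ → ℝ[X]) (t : ℝ) : Fin r → ℝ := fun i => (q i).eval t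

lemma continuous_polyState (r : ℕ) (q : ℕ → ℝ[X]) : Continuous (polyState r q) :=
  continuous_pi fun _ => Polynomial.continuous _

/-- The reflection argument. If the error of a polynomial approximation `y` of the optimal
trajectory `x` is at most `ε` and vanishes at both endpoints, then `2 x - y` competes with `x` as
well; as the endpoint costs agree, the excess cost of `y` is at most a second difference of the
running cost, which is `O(ε²)`. -/
lemma ControlProblem.IsOptimal.exists_cost_le {r : ℕ} [NeZero r] {P : ControlProblem r}
    (hG : ContDiff ℝ 2 P.integrand) {x : ℝ → Fin r → ℝ} {u v : ℝ → ℝ} (hopt : P.IsOptimal x u)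
    (hv : ContinuousOn v (Icc (-1) 1))
    (hder : ∀ t ∈ Ioo (-1 : ℝ) 1, HasDerivAt (fun s => x s (lastIdx r)) (v t) t) :
    ∃ C : ℝ, 0 ≤ C ∧ ∀ (q : ℕ → ℝ[X]) (ε : ℝ), ε ≤ 1 →
      (∀ j < r, derivative (q j) = q (j + 1)) →
      (∀ i : Fin r, (q i).eval (-1) = x (-1) i ∧ (q i).eval 1 = x 1 i) →
      (∀ t ∈ Icc (-1 : ℝ) 1,
        (∀ i : Fin r, |x t i - (q i).eval t| ≤ ε) ∧ |v t - (q r).eval t| ≤ ε) →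
      P.cost (polyState r q) (fun t => P.feedback (polyState r q t, (q r).eval t)) ≤
        P.cost x u + C * ε ^ 2 := by
  obtain ⟨hfeas, hmin⟩ := hopt
  have hxc : ContinuousOn x (Icc (-1) 1) := continuousOn_pi.2 fun i => by
    have := (hfeas.state i).continuousOn
    rwa [uIcc_of_le (by norm_num)] at this
  have hlast : ∀ᵐ t ∂(volume.restrict (Icc (-1 : ℝ) 1)),
      HasDerivAt (fun s => x s (lastIdx r)) (v t) t := by
    rw [← restrict_Ioo_eq_restrict_Icc, ae_restrict_iff' measurableSet_Ioo]
    exact Filter.Eventually.of_forall hder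
  set z : ℝ → (Fin r → ℝ) × ℝ := fun t => (x t, v t) with hz
  have hzc : ContinuousOn z (Icc (-1) 1) := hxc.prodMk hv
  obtain ⟨R, hR⟩ := isCompact_Icc.exists_bound_of_continuousOn hzc
  obtain ⟨C, hC0, hC⟩ := exists_second_difference_le hG R
  have hcost : P.cost x u =
      (∫ t in (-1 : ℝ)..1, P.integrand (z t)) + P.E (x (-1), x 1) := by
    unfold ControlProblem.cost
    congr 1
    refine intervalIntegral.integral_congr_ae ?_
    have h1 := (ae_restrict_iff' measurableSet_Icc).1 (hlast.and hfeas.last)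
    filter_upwards [h1] with t ht hmem
    rw [uIoc_of_le (by norm_num)] at hmem
    obtain ⟨h2, h3⟩ := ht (Ioc_subset_Icc_self hmem)
    rw [P.feedback_unique (h3.unique h2)]
    rfl
  refine ⟨2 * C, by positivity, fun q ε hε hq hend herr => ?_⟩
  have hε0 : 0 ≤ ε := (abs_nonneg _).trans (herr 0 (by simp)).2
  set w : ℝ → (Fin r → ℝ) × ℝ := fun t => (polyState r q t, (q r).eval t) with hw
  have hwc : Continuous w := (continuous_polyState r q).prodMk (Polynomial.continuous _)
  have hζ : ∀ t ∈ Icc (-1 : ℝ) 1, ‖w t - z t‖ ≤ ε := by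
    intro t ht
    refine norm_prod_le_iff.2 ⟨(pi_norm_le_iff_of_nonneg hε0).2 fun i => ?_, ?_⟩
    · have := (herr t ht).1 i
      rw [abs_sub_comm] at this
      exact this
    · have := (herr t ht).2
      rw [abs_sub_comm] at this
      exact this
  -- the reflected pair
  set y' : ℝ → Fin r → ℝ := fun t i => 2 * x t i - (q i).eval t
  set v' : ℝ → ℝ := fun t => 2 * v t - (q r).eval t
  have hfeas' : P.IsFeasible y' fun t => P.feedback (y' t, v' t) := by
    refine P.isFeasible_feedback (fun i => ?_) (fun i j hij => ?_) ?_ ?_ ?_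
    · exact ((hfeas.state i).const_mul 2).sub (absolutelyContinuousOnInterval_poly (q i))
    · filter_upwards [hfeas.chain i j hij] with t ht
      have h1 := (q i).hasDerivAt t
      rw [hq i i.2, ← hij] at h1
      exact (ht.const_mul 2).sub h1
    · filter_upwards [hlast] with t ht
      have h1 := (q (lastIdx r)).hasDerivAt t
      have h2 : ((lastIdx r : Fin r) : ℕ) + 1 = r :=
        Nat.sub_add_cancel (Nat.pos_of_ne_zero (NeZero.ne r))
      rw [hq _ (lastIdx r).2, h2] at h1
      exact (ht.const_mul 2).sub h1
    · exact (hv.const_smul (2 : ℝ)).sub (Polynomial.continuousOn _)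
    · rw [← hfeas.init]
      funext i
      simp only [y', (hend i).1]
      ring
  have hend' : P.E (y' (-1), y' 1) = P.E (x (-1), x 1) := by
    congr 2 <;> funext i
    · simp only [y', (hend i).1]
      ring
    · simp only [y', (hend i).2]
      ring
  have hendq : P.E (polyState r q (-1), polyState r q 1) = P.E (x (-1), x 1) := by
    congr 2 <;> funext i
    · exact (hend i).1
    · exact (hend i).2
  have hcost' := hmin _ _ hfeas'
  have hrefl : ∀ t, (y' t, v' t) = z t - (w t - z t) := by
    intro t
    refine Prod.ext ?_ ?_
    · funext i
      simp only [y', hz, hw, polyState, Prod.fst_sub, Pi.sub_apply]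
      ring
    · simp only [v', hz, hw, Prod.snd_sub]
      ring
  have hGc : Continuous P.integrand := hG.continuous
  have hint : ∀ a : ℝ → (Fin r → ℝ) × ℝ, ContinuousOn a (Icc (-1) 1) →
      IntervalIntegrable (fun t => P.integrand (a t)) volume (-1) 1 := fun a ha =>
    ContinuousOn.intervalIntegrable_of_Icc (by norm_num) (hGc.comp_continuousOn ha)
  have h1 := hint w hwc.continuousOn
  have h2 := hint (fun t => z t - (w t - z t)) (hzc.sub (hwc.continuousOn.sub hzc))
  have h0 := hint z hzc
  have hsum : (∫ t in (-1 : ℝ)..1, (P.integrand (w t) + P.integrand (z t - (w t - z t)) -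
      2 * P.integrand (z t))) ≤ ∫ t in (-1 : ℝ)..1, C * ε ^ 2 := by
    refine intervalIntegral.integral_mono_on (by norm_num) ((h1.add h2).sub (h0.const_mul 2))
      intervalIntegrable_const fun t ht => ?_
    have h3 := hC (z t) (w t - z t) (hR t ht) ((hζ t ht).trans hε)
    rw [add_sub_cancel] at h3
    refine h3.trans (mul_le_mul_of_nonneg_left ?_ hC0)
    have := norm_nonneg (w t - z t)
    have := hζ t ht
    gcongr
  rw [intervalIntegral.integral_sub (h1.add h2) (h0.const_mul 2),
    intervalIntegral.integral_add h1 h2, intervalIntegral.integral_const_mul,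
    intervalIntegral.integral_const] at hsum
  have e2 : P.cost y' (fun t => P.feedback (y' t, v' t)) =
      (∫ t in (-1 : ℝ)..1, P.integrand (z t - (w t - z t))) + P.E (x (-1), x 1) := by
    rw [← hend']
    simp only [← hrefl]
    rfl
  have e1 : P.cost (polyState r q) (fun t => P.feedback (polyState r q t, (q r).eval t)) =
      (∫ t in (-1 : ℝ)..1, P.integrand (w t)) + P.E (x (-1), x 1) := by
    rw [← hendq]
    rfl
  rw [e2, hcost] at hcost'
  rw [e1, hcost]
  simp only [smul_eq_mul] at hsum
  linarith

/-! ### Polynomial approximation of the optimal trajectory -/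

/-- The coordinates of `x`, continued by the strong derivatives of the last one. -/
noncomputable def stateChain {r : ℕ} [NeZero r] (x : ℝ → Fin r → ℝ) (j : ℕ) (t : ℝ) : ℝ :=
  if h : j < r then x t ⟨j, h⟩ else strongDeriv (j - (r - 1)) (fun s => x s (lastIdx r)) t

lemma stateChain_of_lt {r : ℕ} [NeZero r] (x : ℝ → Fin r → ℝ) (i : Fin r) :
    stateChain x i = fun t => x t i := by
  funext t
  simp [stateChain]

lemma stateChain_add {r : ℕ} [NeZero r] (x : ℝ → Fin r → ℝ) (k : ℕ) :
    stateChain x (r - 1 + k) = strongDeriv k fun s => x s (lastIdx r) := by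
  funext t
  have hr : 0 < r := Nat.pos_of_ne_zero (NeZero.ne r)
  rcases k with _ | k
  · have h : r - 1 + 0 < r := by omega
    simp only [stateChain, h, dif_pos, strongDeriv, iteratedDerivWithin_zero]
    rfl
  · have h : ¬ r - 1 + (k + 1) < r := by omega
    simp only [stateChain, h, dif_neg, not_false_eq_true]
    rw [Nat.add_sub_cancel_left]

lemma continuousOn_stateChain {r : ℕ} [NeZero r] {P : ControlProblem r} {x : ℝ → Fin r → ℝ}
    {u : ℝ → ℝ} (h : P.IsFeasible x u) {m k : ℕ}
    (hBV : HasStrongDerivBV m fun t => x t (lastIdx r)) (hk : k < m) {j : ℕ}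
    (hj : j ≤ r - 1 + k) : ContinuousOn (stateChain x j) (Icc (-1) 1) := by
  by_cases hjr : j < r
  · rw [show j = ((⟨j, hjr⟩ : Fin r) : ℕ) from rfl, stateChain_of_lt]
    have := (h.state ⟨j, hjr⟩).continuousOn
    rwa [uIcc_of_le (by norm_num)] at this
  · obtain ⟨i, rfl⟩ : ∃ i, j = r - 1 + i := ⟨j - (r - 1), by omega⟩
    rw [stateChain_add]
    exact continuousOn_strongDeriv hBV (by omega)

lemma hasDerivAt_stateChain {r : ℕ} [NeZero r] {P : ControlProblem r} {x : ℝ → Fin r → ℝ}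
    {u : ℝ → ℝ} (h : P.IsFeasible x u) {m k : ℕ}
    (hBV : HasStrongDerivBV m fun t => x t (lastIdx r)) (hk : k < m) {j : ℕ}
    (hj : j < r - 1 + k) {t : ℝ} (ht : t ∈ Ioo (-1 : ℝ) 1) :
    HasDerivAt (stateChain x j) (stateChain x (j + 1) t) t := by
  by_cases hjr : j + 1 < r
  · have hc := continuousOn_stateChain h hBV hk (j := j + 1) (by omega)
    rw [show j = ((⟨j, by omega⟩ : Fin r) : ℕ) from rfl, stateChain_of_lt]
    rw [show j + 1 = ((⟨j + 1, hjr⟩ : Fin r) : ℕ) from rfl, stateChain_of_lt] at hc ⊢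
    exact hasDerivAt_of_absolutelyContinuous (h.state _) hc (h.chain _ _ rfl) ht
  · obtain ⟨i, rfl⟩ : ∃ i, j = r - 1 + i := ⟨j - (r - 1), by omega⟩
    rw [add_assoc, stateChain_add, stateChain_add]
    exact hasDerivAt_strongDeriv hBV (by omega) ht

/-- For every degree `n ≥ r + m₁`, truncating the Legendre expansion of `x_r^{(m₁)}` after
degree `n` and integrating gives polynomials that match `x` at both endpoints and approximate it to
the order `n^{-(m - m₁ - 1/2)}`. -/
lemma exists_poly_approx {r : ℕ} [NeZero r] {P : ControlProblem r} {x : ℝ → Fin r → ℝ}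
    {u : ℝ → ℝ} (h : P.IsFeasible x u) {m₁ s : ℕ}
    (hBV : HasStrongDerivBV (m₁ + s + 1) fun t => x t (lastIdx r)) :
    ∃ A : ℝ, 0 ≤ A ∧ ∀ n : ℕ, r + m₁ ≤ n → ∃ q : ℕ → ℝ[X],
      q (r - 1 + m₁) = legendreTrunc (strongDeriv m₁ fun t => x t (lastIdx r)) n ∧
      (∀ j < r - 1 + m₁, derivative (q j) = q (j + 1) ∧
        (q j).eval (-1) = stateChain x j (-1) ∧ (q j).eval 1 = stateChain x j 1) ∧
      ∀ j ≤ r - 1 + m₁, (q j).natDegree ≤ n + (r - 1 + m₁ - j) ∧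
        ∀ t ∈ Icc (-1 : ℝ) 1, |stateChain x j t - (q j).eval t| ≤
          A / (((n : ℝ) + 1) ^ s * √((n : ℝ) + 1)) := by
  set ξ : ℝ → ℝ := fun t => x t (lastIdx r)
  obtain ⟨C, hC0, hC⟩ := exists_sub_legendreTrunc_le s (fun k => strongDeriv (m₁ + k) ξ)
    (fun k hk => continuousOn_strongDeriv hBV (by omega))
    (fun k hk t ht => hasDerivAt_strongDeriv hBV (by omega) ht)
    (boundedVariationOn_strongDeriv hBV (by omega))
  refine ⟨2 ^ (r - 1 + m₁) * C, by positivity, fun n hn => ?_⟩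
  have hY : stateChain x (r - 1 + m₁) = strongDeriv m₁ ξ := stateChain_add x m₁
  obtain ⟨q, hq0, hq1, hq2, -⟩ := exists_chain_approx (r - 1 + m₁) (stateChain x) 0
    (fun j hj => continuousOn_stateChain h hBV (k := m₁) (by omega) hj)
    (fun j hj t ht => hasDerivAt_stateChain h hBV (k := m₁) (by omega) hj ht)
    (legendreTrunc (strongDeriv m₁ ξ) n) (C / (((n : ℝ) + 1) ^ s * √((n : ℝ) + 1)))
    (fun t ht => by rw [hY]; exact hC n t ht)
    (fun p hp => by
      rw [hY]
      refine integral_sub_legendreTrunc_mul (continuousOn_strongDeriv hBV (by omega)) n p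
        (hp.trans_le ?_)
      exact_mod_cast (by omega : 0 + (r - 1 + m₁) ≤ n + 1))
  refine ⟨q, hq0, hq1, fun j hj => ⟨?_, fun t ht => ?_⟩⟩
  · have := (hq2 j hj).1
    have := natDegree_legendreTrunc_le (strongDeriv m₁ ξ) n
    omega
  · rw [mul_div_assoc]
    exact (hq2 j hj).2 t ht

/-! ### Feasibility of the approximations and the convergence rate -/

/-- The uniform margin with which the optimal trajectory and its control satisfy the bounds. -/
lemma SearchBounds.LargeEnough.exists_margin {r : ℕ} [NeZero r] {P : ControlProblem r}
    {x : ℝ → Fin r → ℝ} {u v : ℝ → ℝ} {b : SearchBounds r} {m₁ : ℕ}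
    (hb : b.LargeEnough m₁ x u) (hfeas : P.IsFeasible x u) (hv : ContinuousOn v (Icc (-1) 1))
    (hder : ∀ t ∈ Ioo (-1 : ℝ) 1, HasDerivAt (fun s => x s (lastIdx r)) (v t) t) :
    ∃ δ > 0, ∀ t ∈ Icc (-1 : ℝ) 1, ∀ w : (Fin r → ℝ) × ℝ, ‖w - (x t, v t)‖ ≤ δ →
      (∀ i, b.xlo i ≤ w.1 i ∧ w.1 i ≤ b.xhi i) ∧ b.ulo ≤ P.feedback w ∧ P.feedback w ≤ b.uhi := by
  have hne : (Icc (-1 : ℝ) 1).Nonempty := ⟨0, by simp⟩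
  have hxi : ∀ i, ContinuousOn (fun t => x t i) (Icc (-1) 1) := fun i => by
    have := (hfeas.state i).continuousOn
    rwa [uIcc_of_le (by norm_num)] at this
  have hxc : ContinuousOn x (Icc (-1) 1) := continuousOn_pi.2 hxi
  have hzc : ContinuousOn (fun t => (x t, v t)) (Icc (-1) 1) := hxc.prodMk hv
  obtain ⟨R, hR⟩ := isCompact_Icc.exists_bound_of_continuousOn hzc
  obtain ⟨ε, hε, hu⟩ := hb.control
  obtain ⟨δ₁, hδ₁, hfb⟩ := exists_forall_abs_sub_le P.continuous_feedback R hε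
  have hmargin : ∀ i : Fin r, ∃ η > 0, ∀ t ∈ Icc (-1 : ℝ) 1,
      b.xlo i + η ≤ x t i ∧ x t i ≤ b.xhi i - η := by
    intro i
    obtain ⟨t₁, ht₁, h₁⟩ := isCompact_Icc.exists_isMinOn hne (hxi i)
    obtain ⟨t₂, ht₂, h₂⟩ := isCompact_Icc.exists_isMaxOn hne (hxi i)
    refine ⟨min (x t₁ i - b.xlo i) (b.xhi i - x t₂ i),
      lt_min (sub_pos.2 (hb.state t₁ ht₁ i).1) (sub_pos.2 (hb.state t₂ ht₂ i).2),
      fun t ht => ⟨?_, ?_⟩⟩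
    · have : x t₁ i ≤ x t i := h₁ ht
      linarith [min_le_left (x t₁ i - b.xlo i) (b.xhi i - x t₂ i)]
    · have : x t i ≤ x t₂ i := h₂ ht
      linarith [min_le_right (x t₁ i - b.xlo i) (b.xhi i - x t₂ i)]
  choose η hη hηx using hmargin
  obtain ⟨i₀, -, hi₀⟩ := Finset.exists_min_image Finset.univ η ⟨lastIdx r, Finset.mem_univ _⟩
  -- the control bounds hold everywhere for the continuous representative of the control
  have hctrl : ∀ t ∈ Icc (-1 : ℝ) 1,
      b.ulo + ε ≤ P.feedback (x t, v t) ∧ P.feedback (x t, v t) ≤ b.uhi - ε := by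
    set c : ℝ → ℝ := fun t => P.feedback (x t, v t)
    have hcc : ContinuousOn c (Icc (-1) 1) := P.continuous_feedback.comp_continuousOn hzc
    have hae : ∀ᵐ t ∂(volume.restrict (Icc (-1 : ℝ) 1)), b.ulo + ε ≤ c t ∧ c t ≤ b.uhi - ε := by
      have hlast : ∀ᵐ t ∂(volume.restrict (Icc (-1 : ℝ) 1)),
          HasDerivAt (fun s => x s (lastIdx r)) (v t) t := by
        rw [← restrict_Ioo_eq_restrict_Icc, ae_restrict_iff' measurableSet_Ioo]
        exact Filter.Eventually.of_forall hder
      filter_upwards [hu, hlast, hfeas.last] with t h1 h2 h3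
      rwa [P.feedback_unique (h3.unique h2)] at h1
    have heq : EqOn c (fun t => max (b.ulo + ε) (min (c t) (b.uhi - ε))) (Icc (-1) 1) := by
      refine Measure.eqOn_Icc_of_ae_eq (μ := volume) (by norm_num) ?_ hcc
        (continuousOn_const.sup (hcc.inf continuousOn_const))
      filter_upwards [hae] with t ht
      rw [min_eq_left ht.2, max_eq_right ht.1]
    have hle : b.ulo + ε ≤ b.uhi - ε := by
      have : (volume.restrict (Icc (-1 : ℝ) 1)) ≠ 0 := by simp
      have : (ae (volume.restrict (Icc (-1 : ℝ) 1))).NeBot := ae_neBot.2 this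
      obtain ⟨t, ht⟩ := hae.exists
      exact ht.1.trans ht.2
    intro t ht
    have := heq ht
    simp only at this
    change b.ulo + ε ≤ c t ∧ c t ≤ b.uhi - ε
    constructor
    · rw [this]; exact le_max_left _ _
    · rw [this]; exact max_le hle (min_le_right _ _)
  refine ⟨min δ₁ (η i₀), lt_min hδ₁ (hη i₀), fun t ht w hw => ⟨fun i => ?_, ?_⟩⟩
  · have h1 : |w.1 i - x t i| ≤ η i := by
      have h2 : ‖(w - (x t, v t)).1 i‖ ≤ ‖w - (x t, v t)‖ :=
        (norm_le_pi_norm _ i).trans (norm_fst_le _)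
      exact (h2.trans (hw.trans (min_le_right _ _))).trans (hi₀ i (Finset.mem_univ i))
    have h3 := hηx i t ht
    have h4 := abs_le.1 h1
    constructor <;> linarith [h3.1, h3.2, h4.1, h4.2]
  · have h1 := abs_le.1 (hfb (x t, v t) w (hR t ht) (hw.trans (min_le_left _ _)))
    have h2 := hctrl t ht
    constructor <;> linarith [h1.1, h1.2, h2.1, h2.2]

/-- The spectral constraint holds for the exact Legendre coefficients of `x_r^{(m₁)}`. -/
lemma SearchBounds.LargeEnough.sum_legendreCoeff_le {r : ℕ} [NeZero r]
    {x : ℝ → Fin r → ℝ} {u : ℝ → ℝ} {b : SearchBounds r} {m m₁ : ℕ}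
    (hb : b.LargeEnough m₁ x u) (hBV : HasStrongDerivBV m fun t => x t (lastIdx r))
    (hm : m₁ < m) (n : ℕ) :
    ∑ k ∈ Finset.range (n + 1),
      |legendreCoeff (strongDeriv m₁ fun t => x t (lastIdx r)) k| ≤ b.d := by
  obtain ⟨U, hU, hd⟩ := hb.spectral
  set ξ : ℝ → ℝ := fun t => x t (lastIdx r)
  set c : ℝ := 6 / √Real.pi * (U + (eVariationOn (strongDeriv (m₁ + 1) ξ) (Icc (-1) 1)).toReal)
  have hU0 : 0 ≤ U := (abs_nonneg _).trans (hU 0 (by simp))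
  have hc0 : 0 ≤ c := by positivity
  have hk : ∀ k : ℕ, |legendreCoeff (strongDeriv m₁ ξ) (k + 1)| ≤
      c * (1 / ((k : ℝ) + 1) ^ (3 / 2 : ℝ)) :=
    abs_legendreCoeff_succ_le (continuousOn_strongDeriv hBV hm)
      (fun t ht => hasDerivAt_strongDeriv hBV hm ht)
      (boundedVariationOn_strongDeriv hBV hm) hU
  have hs : Summable fun k : ℕ => 1 / ((k : ℝ) + 1) ^ (3 / 2 : ℝ) := by
    have := (summable_nat_add_iff 1).2
      (Real.summable_one_div_nat_rpow.2 (by norm_num : (1 : ℝ) < 3 / 2))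
    simpa using this
  rw [Finset.sum_range_succ']
  have h1 : ∑ k ∈ Finset.range n, |legendreCoeff (strongDeriv m₁ ξ) (k + 1)| ≤
      c * ∑' k : ℕ, 1 / ((k : ℝ) + 1) ^ (3 / 2 : ℝ) := by
    refine (Finset.sum_le_sum fun k _ => hk k).trans ?_
    rw [← Finset.mul_sum]
    exact mul_le_mul_of_nonneg_left (hs.sum_le_tsum _ fun _ _ => by positivity) hc0
  linarith

/-- For large `N` the discretized problem has a feasible point whose cost exceeds that of the
optimal pair by at most `O(N^{-(2 (m - m₁) - 1)})`. -/
lemma ControlProblem.IsOptimal.exists_discrete_le {r : ℕ} [NeZero r] {P : ControlProblem r}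
    (hG : ContDiff ℝ 2 P.integrand) {x : ℝ → Fin r → ℝ} {u : ℝ → ℝ} (hopt : P.IsOptimal x u)
    {m₁ s : ℕ} (hm₁ : 1 ≤ m₁) (hBV : HasStrongDerivBV (m₁ + s + 1) fun t => x t (lastIdx r))
    {b : SearchBounds r} (hb : b.LargeEnough m₁ x u) :
    ∃ (A : ℝ) (n₀ : ℕ), 0 ≤ A ∧ ∀ N n : ℕ, n₀ ≤ n → N + 1 = n + (r - 1 + m₁) →
      ∃ (yb : Fin (N + 1 + 1) → Fin r → ℝ) (vb : Fin (N + 1 + 1) → ℝ),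
        P.IsDiscreteFeasible b m₁ (N + 1) yb vb ∧
        P.discreteCost yb ≤ P.cost x u + A / ((n : ℝ) + 1) ^ (2 * s + 1) := by
  have hr : 0 < r := Nat.pos_of_ne_zero (NeZero.ne r)
  set ξ : ℝ → ℝ := fun t => x t (lastIdx r) with hξ
  have hv : ContinuousOn (strongDeriv 1 ξ) (Icc (-1) 1) := continuousOn_strongDeriv hBV (by omega)
  have hder : ∀ t ∈ Ioo (-1 : ℝ) 1, HasDerivAt ξ (strongDeriv 1 ξ t) t := fun t ht => by
    have := hasDerivAt_strongDeriv hBV (k := 0) (by omega) ht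
    rwa [show strongDeriv 0 ξ = ξ from iteratedDerivWithin_zero] at this
  obtain ⟨C, hC0, hC⟩ := hopt.exists_cost_le hG hv hder
  obtain ⟨A, hA0, hA⟩ := exists_poly_approx hopt.1 hBV
  obtain ⟨δ, hδ, hmargin⟩ := hb.exists_margin hopt.1 hv hder
  obtain ⟨n₁, hn₁⟩ := exists_nat_ge ((A / min δ 1) ^ 2)
  refine ⟨C * A ^ 2, max n₁ (r + m₁), by positivity, fun N n hn hN => ?_⟩
  obtain ⟨q, hqL, hq1, hq2⟩ := hA n ((le_max_right _ _).trans hn)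
  set L := r - 1 + m₁ with hL
  set ε : ℝ := A / (((n : ℝ) + 1) ^ s * √((n : ℝ) + 1)) with hεd
  have hsq : 0 < √((n : ℝ) + 1) := Real.sqrt_pos.2 (by positivity)
  have hmin : 0 < min δ 1 := lt_min hδ one_pos
  have hε : ε ≤ min δ 1 := by
    have h1 : A / min δ 1 ≤ √((n : ℝ) + 1) := by
      apply Real.le_sqrt_of_sq_le
      have : (n₁ : ℝ) ≤ n := by exact_mod_cast (le_max_left _ _).trans hn
      linarith
    have h2 : (1 : ℝ) ≤ ((n : ℝ) + 1) ^ s :=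
      one_le_pow₀ (by have : (0 : ℝ) ≤ n := by positivity
                      linarith)
    rw [hεd, div_le_iff₀ (by positivity)]
    rw [div_le_iff₀ hmin] at h1
    calc A ≤ √((n : ℝ) + 1) * min δ 1 := h1
      _ = min δ 1 * (1 * √((n : ℝ) + 1)) := by ring
      _ ≤ _ := by gcongr
  have hdeg : ∀ j ≤ L, (q j).natDegree ≤ N + 1 := fun j hj => by
    have := (hq2 j hj).1
    omega
  have hlast' : r - 1 + 1 = r := by omega
  have herr : ∀ t ∈ Icc (-1 : ℝ) 1,
      (∀ i : Fin r, |x t i - (q i).eval t| ≤ ε) ∧ |strongDeriv 1 ξ t - (q r).eval t| ≤ ε := by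
    intro t ht
    constructor
    · intro i
      have := (hq2 i (by have := i.2; omega)).2 t ht
      rwa [stateChain_of_lt] at this
    · have := (hq2 (r - 1 + 1) (by omega)).2 t ht
      rwa [stateChain_add, hlast'] at this
  have hnear : ∀ t ∈ Icc (-1 : ℝ) 1,
      ‖(polyState r q t, (q r).eval t) - (x t, strongDeriv 1 ξ t)‖ ≤ δ := by
    intro t ht
    refine norm_prod_le_iff.2 ⟨(pi_norm_le_iff_of_nonneg hδ.le).2 fun i => ?_, ?_⟩
    · have := (herr t ht).1 i
      rw [abs_sub_comm] at this
      exact this.trans (hε.trans (min_le_left _ _))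
    · have := (herr t ht).2
      rw [abs_sub_comm] at this
      exact this.trans (hε.trans (min_le_left _ _))
  have hiter : ∀ j ≤ m₁, derivative^[j] (q (r - 1)) = q (r - 1 + j) := by
    intro j
    induction j with
    | zero => intro _; rfl
    | succ j ih =>
      intro hj
      rw [Function.iterate_succ_apply', ih (by omega), (hq1 (r - 1 + j) (by omega)).1]
      rfl
  set node := lglNode (N + 1) with hnode
  have hbound : ∀ k, _ := fun k => hmargin (node k) (lglNode_mem_Icc N k) _
    (hnear (node k) (lglNode_mem_Icc N k))
  refine ⟨fun k => polyState r q (node k),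
    fun k => P.feedback (polyState r q (node k), (q r).eval (node k)), ?_, ?_⟩
  · refine ⟨fun i j hij => ?_, ?_, ?_, fun k => (hbound k).1, fun k => (hbound k).2, ?_, ?_⟩
    · have hi := i.2
      have := diffMatrix_pow_mulVec N (hdeg i (by omega)) 1
      rw [pow_one, Function.iterate_one, (hq1 i (by omega)).1, ← hij] at this
      exact this
    · have := diffMatrix_pow_mulVec N (hdeg (r - 1) (by omega)) 1
      rw [pow_one, Function.iterate_one, (hq1 (r - 1) (by omega)).1, hlast'] at this
      refine this.trans (funext fun k => ?_)
      exact (P.feedback_spec (polyState r q (node k), (q r).eval (node k))).symm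
    · rw [← hopt.1.init]
      funext i
      have h1 := (hq1 i (by have := i.2; omega)).2.1
      rw [stateChain_of_lt] at h1
      simp only [polyState, hnode, lglNode_zero]
      exact h1
    · intro j hj1 hj2
      have h1 := congrFun (diffMatrix_pow_mulVec N (hdeg (r - 1) (by omega)) j) 0
      have h2 := (hq1 (r - 1 + j) (by omega)).2.1
      rw [hiter j (by omega), lglNode_zero, h2, stateChain_add] at h1
      have h3 := hb.initial_deriv j hj1 hj2
      rw [← h1] at h3
      exact ⟨h3.1.le, h3.2.le⟩
    · have h1 := diffMatrix_pow_mulVec N (hdeg (r - 1) (by omega)) m₁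
      rw [hiter m₁ le_rfl, hqL] at h1
      have h2 : interp (N + 1) ((diffMatrix (N + 1) ^ m₁) *ᵥ
          fun k => polyState r q (node k) (lastIdx r)) = legendreTrunc (strongDeriv m₁ ξ) n := by
        refine (congrArg (interp (N + 1)) h1).trans (interp_eval_poly N ?_)
        rw [← hqL]
        exact hdeg L le_rfl
      rw [h2]
      have h3 : N + 1 + 2 - (r + m₁) = n + 1 := by omega
      rw [h3]
      refine le_trans (le_of_eq (Finset.sum_congr rfl fun k hk => ?_))
        (hb.sum_legendreCoeff_le hBV (by omega) n)
      rw [legendreCoeff_legendreTrunc _ (Nat.lt_succ_iff.1 (Finset.mem_range.1 hk))]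
  · have hstate : stateInterp (fun k => polyState r q (node k)) = polyState r q := by
      funext t i
      simp only [stateInterp, polyState]
      rw [interp_eval_poly N (hdeg i (by have := i.2; omega))]
    have hctrl : P.controlInterp (fun k => polyState r q (node k)) =
        fun t => P.feedback (polyState r q t, (q r).eval t) := by
      funext t
      simp only [ControlProblem.controlInterp, hstate]
      have : (interp (N + 1) fun k => polyState r q (node k) (lastIdx r)) = q (r - 1) :=
        interp_eval_poly N (hdeg (r - 1) (by omega))
      rw [this, (hq1 (r - 1) (by omega)).1, hlast']
      rfl
    rw [ControlProblem.discreteCost, hstate, hctrl]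
    refine (hC q ε (hε.trans (min_le_right _ _)) (fun j hj => (hq1 j (by omega)).1)
      (fun i => ?_) herr).trans (le_of_eq ?_)
    · have := (hq1 i (by have := i.2; omega)).2
      rwa [stateChain_of_lt] at this
    · rw [hεd, div_pow, mul_pow, Real.sq_sqrt (by positivity), mul_div_assoc, ← pow_mul,
        pow_succ ((n : ℝ) + 1), mul_comm s 2]

end PSControl

theorem mainTheorem3 (r : ℕ) [NeZero r] (P : PSControl.ControlProblem r) (m m₁ : ℕ)
    (hm : 2 ≤ m) (hm₁ : 1 ≤ m₁) (hm₁m : m₁ ≤ m - 1)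
    (hf : ContDiff ℝ m P.f) (hg : ContDiff ℝ m P.g) (hF : ContDiff ℝ m P.F)
    (x : ℝ → Fin r → ℝ) (u : ℝ → ℝ) (hopt : P.IsOptimal x u)
    (hBV : PSControl.HasStrongDerivBV m fun t => x t (PSControl.lastIdx r))
    (b : PSControl.SearchBounds r) (hb : b.LargeEnough m₁ x u)
    (N₁ : ℕ) (xb : (N : ℕ) → Fin (N + 1) → Fin r → ℝ) (ub : (N : ℕ) → Fin (N + 1) → ℝ)
    (hdisc : ∀ N ≥ N₁, P.IsDiscreteOptimal b m₁ N (xb N) (ub N)) :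
    ∃ M₁ : ℝ, ∀ N ≥ N₁, r + m₁ + 1 < N →
      |P.cost x u - P.discreteCost (xb N)| ≤
        M₁ / ((N : ℝ) - r - m₁ - 1) ^ (2 * m - 2 * m₁ - 1) := by
  obtain ⟨s, rfl⟩ : ∃ s, m = m₁ + s + 1 := ⟨m - m₁ - 1, by omega⟩
  have hr : 0 < r := Nat.pos_of_ne_zero (NeZero.ne r)
  have hG : ContDiff ℝ 2 P.integrand :=
    (P.contDiff_integrand hf hg hF).of_le (by exact_mod_cast hm)
  obtain ⟨A, n₀, hA0, hA⟩ := hopt.exists_discrete_le hG hm₁ hBV hb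
  have hpow : 2 * (m₁ + s + 1) - 2 * m₁ - 1 = 2 * s + 1 := by omega
  rw [hpow]
  -- the finitely many `N` below the threshold only enlarge the constant
  set e : ℕ → ℝ := fun N => |P.cost x u - P.discreteCost (xb N)| *
    |(N : ℝ) - r - m₁ - 1| ^ (2 * s + 1)
  have he : ∀ N, 0 ≤ e N := fun N => by positivity
  refine ⟨A + ∑ N ∈ Finset.range (n₀ + r + m₁), e N, fun N hN hNr => ?_⟩
  have hden : (0 : ℝ) < (N : ℝ) - r - m₁ - 1 := by
    have : ((r + m₁ + 1 : ℕ) : ℝ) < N := by exact_mod_cast hNr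
    push_cast at this
    linarith
  have hS : 0 ≤ ∑ N ∈ Finset.range (n₀ + r + m₁), e N := Finset.sum_nonneg fun N _ => he N
  rw [le_div_iff₀ (by positivity)]
  by_cases hlt : N < n₀ + r + m₁
  · have h1 := Finset.single_le_sum (fun N _ => he N) (Finset.mem_range.2 hlt)
    have h2 : e N = |P.cost x u - P.discreteCost (xb N)| *
        ((N : ℝ) - r - m₁ - 1) ^ (2 * s + 1) := by
      simp only [e]
      rw [abs_of_pos hden]
    rw [← h2]
    linarith
  · obtain ⟨M, rfl⟩ : ∃ M, N = M + 1 := ⟨N - 1, by omega⟩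
    set n := M + 1 - (r - 1 + m₁) with hn
    obtain ⟨yb, vb, hy, hcost⟩ := hA M n (by omega) (by omega)
    have hup := (hdisc (M + 1) hN).2 yb vb hy
    have hlow := hopt.2 _ _ (P.isFeasible_of_isDiscreteFeasible (hdisc (M + 1) hN).1)
    have hlow' : P.cost x u ≤ P.discreteCost (xb (M + 1)) := hlow
    have hnr : ((M + 1 : ℕ) : ℝ) - r - m₁ - 1 ≤ (n : ℝ) + 1 := by
      have h3 : M + 1 ≤ n + 1 + r + m₁ := by omega
      have : ((M + 1 : ℕ) : ℝ) ≤ ((n + 1 + r + m₁ : ℕ) : ℝ) := by exact_mod_cast h3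
      push_cast at this ⊢
      linarith
    have habs : |P.cost x u - P.discreteCost (xb (M + 1))| ≤ A / ((n : ℝ) + 1) ^ (2 * s + 1) := by
      rw [abs_le]
      have : 0 ≤ A / ((n : ℝ) + 1) ^ (2 * s + 1) := by positivity
      constructor <;> linarith
    calc _ ≤ A / ((n : ℝ) + 1) ^ (2 * s + 1) * ((n : ℝ) + 1) ^ (2 * s + 1) := by
          gcongr
      _ = A := div_mul_cancel₀ _ (by positivity)
      _ ≤ _ := by linarith
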